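/- For a nonempty compact set $\tau\subset\mathbb C$ and $f:\tau\to\mathbb C$ let $$\operatorname{var}(f,\tau)=\sup_{\gamma}\ \frac{1}{\operatorname{vf}(\gamma)}\,\operatorname{cvar}(f,\gamma),$$ where $\gamma$ runs over all continuous curves $\gamma:[0,1]\to\mathbb C$. Here $\operatorname{cvar}(f,\gamma)$ is the supremum of $\sum_i|f(\gamma(t_{i+1}))-f(\gamma(t_i))|$ over finite sequences $t_1\le t_2\le\dots\le t_n$ in $[0,1]$ with $\gamma(t_i)\in\tau$ (and is $0$ if $\gamma$ misses $\tau$), and $\operatorname{vf}(\gamma)$ is the supremum over all lines $\ell$ in the plane of the number of entry times of $\gamma$ on $\ell$, that is, of times $t$ with $\gamma(t)\in\ell$ such that $t=0$ or $\gamma$ is off $\ell$ on some interval $(s,t)$ with $s<t$; the product is taken to be $0$ if $\operatorname{vf}(\gamma)=\infty$. Let $BV(\tau)$ be the Banach algebra of all $f:\tau\to\mathbb C$ with $\|f\|_{BV(\tau)}=\|f\|_\infty+\operatorname{var}(f,\tau)<\infty$, and let $AC(\tau)$ be its closed subalgebra generated by the functions $1$, $z\mapsto z$ and $z\mapsto\bar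 z$, with the same norm. Call $V\subset\mathbb C$ gridlike if it is a closed polygonal region with sides parallel to the axes, i.e. a nonempty finite union of nondegenerate closed rectangles with sides parallel to the axes ($V$ need not be convex, simply connected or connected). **Proposition.** Let $V$ be a gridlike set, let $\sigma\subset\mathbb C$ be compact with $V\subseteq\sigma$, and let $I_V=\{f\in AC(\sigma): f\equiv 0\text{ on }V\}$. Then $[f]\mapsto f|_V$ is a well-defined Banach algebra isomorphism from $AC(\sigma)/I_V$ (with the quotient norm) onto $AC(V)$, i.e. an algebra isomorphism which is bounded with bounded inverse. Moreover, for every nondegenerate closed rectangle $R\supseteq V$ with sides parallel to the axes there is a constant $C=C(V,R)$ such that every $f\in AC(V)$ has an extension $F\in AC(R)$, $F|_V=f$, with $\|F\|_{BV(R)}\le C\,\|f\|_{BV(V)}$. -/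

import Mathlib

noncomputable section

namespace ACPlane

open Set Filter Topology
open scoped ENNReal ComplexConjugate

/-! ### Two-dimensional variation -/

/-- The real line `{x + i y : a x + b y = c}` in the plane; it is a line as soon as
`(a, b) ≠ (0, 0)`. -/
def line (a b c : ℝ) : Set ℂ := {z | a * z.re + b * z.im = c}

/-- The parameters at which the curve `γ` enters the set `l`: either `γ` starts in `l`, or `γ`
is in `l` at time `t` and outside `l` immediately before time `t`. -/
def entryTimes (γ : C(unitInterval, ℂ)) (l : Set ℂ) : Set unitInterval :=
  {t | γ t ∈ l ∧ (t = 0 ∨ ∃ s < t, ∀ r ∈ Ioo s t, γ r ∉ l)}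

/-- The number of times `γ` crosses `l`. -/
def vfLine (γ : C(unitInterval, ℂ)) (l : Set ℂ) : ℕ∞ := (entryTimes γ l).encard

/-- The variation factor: the supremum over all lines of the number of crossings. It is at least
one, since `γ` enters at time `0` every line through its starting point. -/
def vf (γ : C(unitInterval, ℂ)) : ℕ∞ :=
  ⨆ (a : ℝ) (b : ℝ) (c : ℝ) (_ : (a, b) ≠ (0, 0)), vfLine γ (line a b c)

/-- The weight factor `1 / vf γ`, which is `0` if `vf γ = ∞`. -/
def rho (γ : C(unitInterval, ℂ)) : ℝ≥0∞ := ((vf γ : ℕ∞) : ℝ≥0∞)⁻¹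

/-- The variation of `f : σ → ℂ` along the curve `γ`: the supremum of
`∑ |f (γ (t (i + 1))) - f (γ (t i))|` over all finite nondecreasing sequences of parameters `t i`
with `γ (t i) ∈ σ`. -/
def cvar {σ : Set ℂ} (f : σ → ℂ) (γ : C(unitInterval, ℂ)) : ℝ≥0∞ :=
  eVariationOn (fun t : {t : unitInterval // γ t ∈ σ} => f ⟨γ t, t.2⟩) univ

/-- The two-dimensional variation of `f : σ → ℂ`. -/
def var {σ : Set ℂ} (f : σ → ℂ) : ℝ≥0∞ := ⨆ γ : C(unitInterval, ℂ), rho γ * cvar f γ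

/-- The (extended) supremum norm. -/
def supNorm {σ : Set ℂ} (f : σ → ℂ) : ℝ≥0∞ := ⨆ z : σ, ‖f z‖ₑ

/-- The (extended) `BV` norm `‖f‖_∞ + var f`. -/
def bvNorm {σ : Set ℂ} (f : σ → ℂ) : ℝ≥0∞ := supNorm f + var f

section lemmas

variable {σ : Set ℂ}

lemma le_supNorm (f : σ → ℂ) (z : σ) : ‖f z‖ₑ ≤ supNorm f := le_iSup (fun z : σ => ‖f z‖ₑ) z

lemma le_bvNorm (f : σ → ℂ) (z : σ) : ‖f z‖ₑ ≤ bvNorm f :=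
  (le_supNorm f z).trans le_self_add

lemma rho_le_one (γ : C(unitInterval, ℂ)) : rho γ ≤ 1 := by
  have h1 : 1 ≤ vf γ := by
    have h0 : (0 : unitInterval) ∈ entryTimes γ (line 1 0 (γ 0).re) :=
      ⟨by simp [line], Or.inl rfl⟩
    have h2 : 1 ≤ vfLine γ (line 1 0 (γ 0).re) := by
      rw [vfLine, Set.one_le_encard_iff_nonempty]
      exact ⟨0, h0⟩
    have h3 : ((1 : ℝ), (0 : ℝ)) ≠ (0, 0) := by simp
    unfold vf
    exact h2.trans (le_iSup_of_le 1 (le_iSup_of_le 0 (le_iSup_of_le (γ 0).re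
      (le_iSup_of_le h3 le_rfl))))
  rw [rho, ENNReal.inv_le_one]
  exact_mod_cast h1

lemma rho_ne_top (γ : C(unitInterval, ℂ)) : rho γ ≠ ∞ :=
  ((rho_le_one γ).trans_lt ENNReal.one_lt_top).ne

lemma var_le_of_cvar_le {f : σ → ℂ} {B : ℝ≥0∞}
    (h : ∀ γ : C(unitInterval, ℂ), rho γ * cvar f γ ≤ B) : var f ≤ B := iSup_le h

lemma le_var (f : σ → ℂ) (γ : C(unitInterval, ℂ)) : rho γ * cvar f γ ≤ var f :=
  le_iSup (fun γ => rho γ * cvar f γ) γ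

lemma sum_le_cvar (f : σ → ℂ) (γ : C(unitInterval, ℂ)) (n : ℕ) {u : ℕ → {t : unitInterval // γ t ∈ σ}}
    (hu : Monotone u) :
    ∑ i ∈ Finset.range n, edist (f ⟨γ (u (i + 1)), (u (i + 1)).2⟩) (f ⟨γ (u i), (u i).2⟩)
      ≤ cvar f γ :=
  eVariationOn.sum_le (f := fun t : {t : unitInterval // γ t ∈ σ} => f ⟨γ t, t.2⟩) hu
    (fun _ => mem_univ _)

lemma cvar_le {f : σ → ℂ} {γ : C(unitInterval, ℂ)} {B : ℝ≥0∞}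
    (h : ∀ (n : ℕ) (u : ℕ → {t : unitInterval // γ t ∈ σ}), Monotone u →
      ∑ i ∈ Finset.range n,
        edist (f ⟨γ (u (i + 1)), (u (i + 1)).2⟩) (f ⟨γ (u i), (u i).2⟩) ≤ B) :
    cvar f γ ≤ B :=
  iSup_le fun p => h p.1 p.2.1 p.2.2.1

lemma bvNorm_const_le (c : ℂ) : bvNorm (fun _ : σ => c) ≤ ‖c‖ₑ := by
  have h : var (fun _ : σ => c) ≤ 0 := by
    refine var_le_of_cvar_le fun γ => ?_
    have : cvar (fun _ : σ => c) γ ≤ 0 := cvar_le fun n u _ => by simp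
    rw [nonpos_iff_eq_zero] at this
    simp [this]
  have h' : supNorm (fun _ : σ => c) ≤ ‖c‖ₑ := iSup_le fun _ => le_rfl
  simpa [bvNorm] using add_le_add h' h

lemma bvNorm_add_le (f g : σ → ℂ) : bvNorm (f + g) ≤ bvNorm f + bvNorm g := by
  have h1 : supNorm (f + g) ≤ supNorm f + supNorm g := iSup_le fun z =>
    (enorm_add_le _ _).trans (add_le_add (le_supNorm f z) (le_supNorm g z))
  have h2 : var (f + g) ≤ var f + var g := by
    refine var_le_of_cvar_le fun γ => ?_
    have : cvar (f + g) γ ≤ cvar f γ + cvar g γ := cvar_le fun n u hu => by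
      refine le_trans ?_ (add_le_add (sum_le_cvar f γ n hu) (sum_le_cvar g γ n hu))
      rw [← Finset.sum_add_distrib]
      exact Finset.sum_le_sum fun i _ => edist_add_add_le _ _ _ _
    calc rho γ * cvar (f + g) γ ≤ rho γ * (cvar f γ + cvar g γ) := by gcongr
      _ = rho γ * cvar f γ + rho γ * cvar g γ := mul_add _ _ _
      _ ≤ _ := add_le_add (le_var f γ) (le_var g γ)
  calc bvNorm (f + g) ≤ (supNorm f + supNorm g) + (var f + var g) := add_le_add h1 h2
    _ = _ := by unfold bvNorm; ring

lemma edist_mul_mul_le (a b c d : ℂ) :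
    edist (a * b) (c * d) ≤ ‖a‖ₑ * edist b d + ‖d‖ₑ * edist a c := by
  rw [edist_eq_enorm_sub, edist_eq_enorm_sub, edist_eq_enorm_sub, ← enorm_mul, ← enorm_mul]
  have : a * b - c * d = a * (b - d) + d * (a - c) := by ring
  rw [this]
  exact enorm_add_le _ _

lemma bvNorm_mul_le (f g : σ → ℂ) : bvNorm (f * g) ≤ bvNorm f * bvNorm g := by
  have h1 : supNorm (f * g) ≤ supNorm f * supNorm g := iSup_le fun z => by
    rw [Pi.mul_apply, enorm_mul]
    exact mul_le_mul' (le_supNorm f z) (le_supNorm g z)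
  have h2 : var (f * g) ≤ supNorm f * var g + supNorm g * var f := by
    refine var_le_of_cvar_le fun γ => ?_
    have : cvar (f * g) γ ≤ supNorm f * cvar g γ + supNorm g * cvar f γ :=
      cvar_le fun n u hu => by
        refine le_trans ?_ (add_le_add (mul_le_mul' le_rfl (sum_le_cvar g γ n hu))
          (mul_le_mul' le_rfl (sum_le_cvar f γ n hu)))
        rw [Finset.mul_sum, Finset.mul_sum, ← Finset.sum_add_distrib]
        refine Finset.sum_le_sum fun i _ => (edist_mul_mul_le _ _ _ _).trans ?_
        exact add_le_add (mul_le_mul' (le_supNorm f _) le_rfl)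
          (mul_le_mul' (le_supNorm g _) le_rfl)
    calc rho γ * cvar (f * g) γ
        ≤ rho γ * (supNorm f * cvar g γ + supNorm g * cvar f γ) := by gcongr
      _ = supNorm f * (rho γ * cvar g γ) + supNorm g * (rho γ * cvar f γ) := by ring
      _ ≤ _ := add_le_add (mul_le_mul' le_rfl (le_var g γ)) (mul_le_mul' le_rfl (le_var f γ))
  calc bvNorm (f * g)
      ≤ supNorm f * supNorm g + (supNorm f * var g + supNorm g * var f) := add_le_add h1 h2
    _ ≤ supNorm f * supNorm g + (supNorm f * var g + supNorm g * var f) + var f * var g :=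
        le_self_add
    _ = _ := by unfold bvNorm; ring

lemma bvNorm_smul_le (c : ℂ) (f : σ → ℂ) : bvNorm (c • f) ≤ ‖c‖ₑ * bvNorm f := by
  have h : c • f = (fun _ : σ => c) * f := by ext z; simp
  rw [h]
  exact (bvNorm_mul_le _ _).trans (mul_le_mul' (bvNorm_const_le c) le_rfl)

/-- The `BV` norm is lower semicontinuous for pointwise convergence. -/
lemma bvNorm_le_of_tendsto {F : ℕ → σ → ℂ} {g : σ → ℂ} {B : ℝ≥0∞}
    (hF : ∀ z, Tendsto (fun n => F n z) atTop (𝓝 (g z)))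
    (hB : ∀ᶠ n in atTop, bvNorm (F n) ≤ B) : bvNorm g ≤ B := by
  rcases isEmpty_or_nonempty σ with h | h
  · obtain ⟨n, hn⟩ := hB.exists
    rwa [Subsingleton.elim g (F n)]
  refine ENNReal.iSup_add_iSup_le fun z γ => ?_
  have key : ∀ (n : ℕ) (u : ℕ → {t : unitInterval // γ t ∈ σ}), Monotone u →
      ‖g z‖ₑ + rho γ * ∑ i ∈ Finset.range n,
        edist (g ⟨γ (u (i + 1)), (u (i + 1)).2⟩) (g ⟨γ (u i), (u i).2⟩) ≤ B := by
    intro n u hu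
    have ht : Tendsto (fun m => ‖F m z‖ₑ + rho γ * ∑ i ∈ Finset.range n,
        edist (F m ⟨γ (u (i + 1)), (u (i + 1)).2⟩) (F m ⟨γ (u i), (u i).2⟩)) atTop
        (𝓝 (‖g z‖ₑ + rho γ * ∑ i ∈ Finset.range n,
        edist (g ⟨γ (u (i + 1)), (u (i + 1)).2⟩) (g ⟨γ (u i), (u i).2⟩))) := by
      refine Tendsto.add ((hF z).enorm) (ENNReal.Tendsto.const_mul ?_ (Or.inr (rho_ne_top γ)))
      exact tendsto_finsetSum _ fun i _ => (hF _).edist (hF _)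
    refine le_of_tendsto ht (hB.mono fun m hm => le_trans ?_ hm)
    exact add_le_add (le_supNorm _ z)
      ((mul_le_mul' le_rfl (sum_le_cvar (F m) γ n hu)).trans (le_var (F m) γ))
  rcases isEmpty_or_nonempty {t : unitInterval // γ t ∈ σ} with he | he
  · have : cvar g γ = 0 := eVariationOn.subsingleton _ (subsingleton_of_subsingleton)
    rw [this, mul_zero, add_zero]
    have hz : Tendsto (fun m => ‖F m z‖ₑ) atTop (𝓝 ‖g z‖ₑ) := (hF z).enorm
    exact le_of_tendsto hz (hB.mono fun m hm => (le_bvNorm (F m) z).trans hm)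
  · obtain ⟨t⟩ := he
    have : Nonempty (ℕ × {u : ℕ → {t : unitInterval // γ t ∈ σ} // Monotone u ∧ ∀ i, u i ∈ univ}) :=
      ⟨0, fun _ => t, monotone_const, fun _ => mem_univ _⟩
    unfold cvar eVariationOn
    rw [ENNReal.mul_iSup, ENNReal.add_iSup]
    exact iSup_le fun p => key p.1 p.2.1 p.2.2.1

end lemmas

/-! ### The Banach algebra `BV(σ)` -/

/-- The functions of bounded variation on `σ`, as a subalgebra of all functions `σ → ℂ`. -/
def bvSubalgebra (σ : Set ℂ) : Subalgebra ℂ (σ → ℂ) where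
  carrier := {f | bvNorm f < ∞}
  mul_mem' {f g} hf hg := (bvNorm_mul_le f g).trans_lt (ENNReal.mul_lt_top hf hg)
  add_mem' {f g} hf hg := (bvNorm_add_le f g).trans_lt (ENNReal.add_lt_top.2 ⟨hf, hg⟩)
  algebraMap_mem' c := (bvNorm_const_le c).trans_lt enorm_lt_top

/-- The algebra `BV(σ)` of functions of bounded variation on `σ`. -/
def BV (σ : Set ℂ) : Type := bvSubalgebra σ

namespace BV

variable {σ : Set ℂ}

instance : CommRing (BV σ) := inferInstanceAs (CommRing (bvSubalgebra σ))

instance : Algebra ℂ (BV σ) := inferInstanceAs (Algebra ℂ (bvSubalgebra σ))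

/-- The underlying function of an element of `BV(σ)`. -/
def toFun (f : BV σ) : σ → ℂ := f.1

instance : CoeFun (BV σ) (fun _ => σ → ℂ) := ⟨toFun⟩

lemma ext {f g : BV σ} (h : ∀ z, f z = g z) : f = g := Subtype.ext (funext h)

lemma bvNorm_lt_top (f : BV σ) : bvNorm f < ∞ := f.2

@[simp] lemma add_apply (f g : BV σ) (z : σ) : (f + g) z = f z + g z := rfl
@[simp] lemma sub_apply (f g : BV σ) (z : σ) : (f - g) z = f z - g z := rfl
@[simp] lemma neg_apply (f : BV σ) (z : σ) : (-f) z = -f z := rfl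
@[simp] lemma mul_apply (f g : BV σ) (z : σ) : (f * g) z = f z * g z := rfl
@[simp] lemma zero_apply (z : σ) : (0 : BV σ) z = 0 := rfl
@[simp] lemma one_apply (z : σ) : (1 : BV σ) z = 1 := rfl
@[simp] lemma smul_apply (c : ℂ) (f : BV σ) (z : σ) : (c • f) z = c * f z := rfl

/-- The norm `‖f‖ = ‖f‖_∞ + var f`. -/
instance : Norm (BV σ) := ⟨fun f => (bvNorm f).toReal⟩

lemma norm_def (f : BV σ) : ‖f‖ = (bvNorm f).toReal := rfl

lemma norm_apply_le (f : BV σ) (z : σ) : ‖f z‖ ≤ ‖f‖ := by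
  rw [norm_def, ← toReal_enorm]
  exact ENNReal.toReal_mono f.bvNorm_lt_top.ne (le_bvNorm _ z)

lemma norm_add_le' (f g : BV σ) : ‖f + g‖ ≤ ‖f‖ + ‖g‖ := by
  rw [norm_def, norm_def, norm_def, ← ENNReal.toReal_add f.bvNorm_lt_top.ne g.bvNorm_lt_top.ne]
  exact ENNReal.toReal_mono (ENNReal.add_lt_top.2 ⟨f.bvNorm_lt_top, g.bvNorm_lt_top⟩).ne
    (bvNorm_add_le _ _)

lemma norm_mul_le' (f g : BV σ) : ‖f * g‖ ≤ ‖f‖ * ‖g‖ := by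
  rw [norm_def, norm_def, norm_def, ← ENNReal.toReal_mul]
  exact ENNReal.toReal_mono (ENNReal.mul_lt_top f.bvNorm_lt_top g.bvNorm_lt_top).ne
    (bvNorm_mul_le _ _)

lemma norm_smul_le' (c : ℂ) (f : BV σ) : ‖c • f‖ ≤ ‖c‖ * ‖f‖ := by
  rw [norm_def, norm_def, ← toReal_enorm, ← ENNReal.toReal_mul]
  exact ENNReal.toReal_mono (ENNReal.mul_lt_top enorm_lt_top f.bvNorm_lt_top).ne
    (bvNorm_smul_le _ _)

lemma norm_zero' : ‖(0 : BV σ)‖ = 0 := by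
  have h : bvNorm (fun _ : σ => (0 : ℂ)) ≤ 0 := by simpa using bvNorm_const_le (σ := σ) 0
  have h' : bvNorm ((0 : BV σ) : σ → ℂ) = 0 := le_antisymm h bot_le
  rw [norm_def, h']
  rfl

instance : NormedAddCommGroup (BV σ) :=
  AddGroupNorm.toNormedAddCommGroup
    { toFun := fun f => ‖f‖
      map_zero' := norm_zero'
      add_le' := norm_add_le'
      neg' := fun f => by
        have h : ∀ f : BV σ, ‖-f‖ ≤ ‖f‖ := fun f => by
          simpa using norm_smul_le' (-1) f
        exact le_antisymm (h f) (by simpa using h (-f))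
      eq_zero_of_map_eq_zero' := fun f hf => ext fun z => by
        have := norm_apply_le f z
        rw [hf] at this
        simpa using this }

instance : NormedCommRing (BV σ) where
  __ := (inferInstance : NormedAddCommGroup (BV σ))
  __ := (inferInstance : CommRing (BV σ))
  norm_mul_le := norm_mul_le'

instance : NormedAlgebra ℂ (BV σ) where
  norm_smul_le := norm_smul_le'

lemma continuous_apply (z : σ) : Continuous fun f : BV σ => f z := by
  refine (LipschitzWith.of_dist_le_mul (K := 1) fun f g => ?_).continuous
  rw [dist_eq_norm, dist_eq_norm, NNReal.coe_one, one_mul]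
  exact norm_apply_le (f - g) z

instance : CompleteSpace (BV σ) := by
  refine Metric.complete_of_cauchySeq_tendsto fun F hF => ?_
  have hz : ∀ z : σ, ∃ w, Tendsto (fun n => F n z) atTop (𝓝 w) := fun z => by
    refine cauchySeq_tendsto_of_complete (Metric.cauchySeq_iff.2 fun ε hε => ?_)
    obtain ⟨N, hN⟩ := Metric.cauchySeq_iff.1 hF ε hε
    refine ⟨N, fun m hm n hn => lt_of_le_of_lt ?_ (hN m hm n hn)⟩
    rw [dist_eq_norm, dist_eq_norm]
    exact norm_apply_le (F m - F n) z
  choose g hg using hz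
  have key : ∀ ε > 0, ∃ N, ∀ n ≥ N, bvNorm (g - (F n : σ → ℂ)) ≤ ENNReal.ofReal ε := fun ε hε => by
    obtain ⟨N, hN⟩ := Metric.cauchySeq_iff.1 hF ε hε
    refine ⟨N, fun n hn => bvNorm_le_of_tendsto (F := fun m => ((F m - F n : BV σ) : σ → ℂ))
      (fun z => ?_) (eventually_atTop.2 ⟨N, fun m hm => ?_⟩)⟩
    · exact (hg z).sub tendsto_const_nhds
    · have := hN m hm n hn
      rw [dist_eq_norm, norm_def] at this
      exact ENNReal.le_ofReal_iff_toReal_le (bvNorm_lt_top _).ne hε.le |>.2 this.le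
  have hgm : bvNorm g < ∞ := by
    obtain ⟨N, hN⟩ := key 1 one_pos
    have h1 := hN N le_rfl
    have h2 : g = (g - (F N : σ → ℂ)) + (F N : σ → ℂ) := by simp
    rw [h2]
    exact (bvNorm_add_le _ _).trans_lt (ENNReal.add_lt_top.2
      ⟨h1.trans_lt ENNReal.ofReal_lt_top, bvNorm_lt_top _⟩)
  obtain ⟨G, hG⟩ : ∃ G : BV σ, (G : σ → ℂ) = g := ⟨(⟨g, hgm⟩ : bvSubalgebra σ), rfl⟩
  subst hG
  refine ⟨G, Metric.tendsto_atTop.2 fun ε hε => ?_⟩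
  obtain ⟨N, hN⟩ := key (ε / 2) (half_pos hε)
  refine ⟨N, fun n hn => ?_⟩
  rw [dist_comm, dist_eq_norm, norm_def]
  have h := ENNReal.toReal_mono ENNReal.ofReal_ne_top (hN n hn)
  rw [ENNReal.toReal_ofReal (half_pos hε).le] at h
  exact lt_of_le_of_lt h (half_lt_self hε)

end BV

/-! ### The Banach algebra `AC(σ)` -/

/-- The closed subalgebra of `BV(σ)` generated by `1`, `z ↦ z` and `z ↦ conj z`. -/
def acSubalgebra (σ : Set ℂ) : Subalgebra ℂ (BV σ) :=
  (Algebra.adjoin ℂ {g : BV σ | (∀ z, g z = z) ∨ (∀ z, g z = conj (z : ℂ))}).topologicalClosure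

/-- The Banach algebra `AC(σ)` of absolutely continuous functions on `σ`, with the `BV` norm. -/
abbrev AC (σ : Set ℂ) : Type := acSubalgebra σ

instance (σ : Set ℂ) : CompleteSpace (AC σ) :=
  (Subalgebra.isClosed_topologicalClosure _).completeSpace_coe

/-- The ideal `I_V` of functions in `AC(σ)` that vanish on `V`. -/
def vanishingIdeal (σ V : Set ℂ) : Ideal (AC σ) where
  carrier := {f | ∀ z : σ, (z : ℂ) ∈ V → (f : BV σ) z = 0}
  add_mem' {f g} hf hg z hz := by
    have h : ((f + g : AC σ) : BV σ) z = (f : BV σ) z + (g : BV σ) z := rfl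
    rw [h, hf z hz, hg z hz, add_zero]
  zero_mem' _ _ := rfl
  smul_mem' f g hg z hz := by
    have h : ((f * g : AC σ) : BV σ) z = (f : BV σ) z * (g : BV σ) z := rfl
    rw [smul_eq_mul, h, hg z hz, mul_zero]

/-- `I_V` is closed, so that `AC(σ) / I_V` is a Banach algebra in the quotient norm. -/
instance (σ V : Set ℂ) : IsClosed (vanishingIdeal σ V : Set (AC σ)) := by
  have h : (vanishingIdeal σ V : Set (AC σ)) =
      ⋂ (z : σ) (_ : (z : ℂ) ∈ V), {f : AC σ | (f : BV σ) z = 0} := by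
    ext f
    simp only [mem_iInter]
    rfl
  rw [h]
  exact isClosed_iInter fun z => isClosed_iInter fun _ =>
    isClosed_eq ((BV.continuous_apply z).comp continuous_subtype_val) continuous_const

/-! ### Gridlike sets -/

/-- A nondegenerate closed rectangle with sides parallel to the axes. -/
def IsRectangle (R : Set ℂ) : Prop :=
  ∃ a b c d : ℝ, a < b ∧ c < d ∧ R = Icc a b ×ℂ Icc c d

/-- A gridlike set: a closed polygonal region with sides parallel to the axes, that is, a nonempty
finite union of nondegenerate closed rectangles with sides parallel to the axes. It need not be
convex, simply connected or connected. -/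
def IsGridlike (V : Set ℂ) : Prop :=
  ∃ S : Set (Set ℂ), S.Finite ∧ S.Nonempty ∧ (∀ R ∈ S, IsRectangle R) ∧ V = ⋃₀ S

end ACPlane

end

noncomputable section

namespace ACPlane

open Set Filter Topology MeasureTheory Polynomial
open scoped ENNReal ComplexConjugate

/-! ### Crossings of lines -/

/-! The whole theorem comes down to surjectivity of the restriction map `AC σ → AC V` for bounded `σ
⊇ V`. Restriction is a contractive algebra homomorphism between Banach algebras with kernel
`vanishingIdeal σ V`, so once it is onto, the open mapping theorem gives both the bounded inverse on
the quotient and the extension constant for a rectangle.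

Surjectivity is local. Near a point `v` only the rectangles of `V` containing `v` matter. Clamping
the coordinates gives a retraction `M` of the plane onto such a rectangle `A`, and `f ∘ M` extends
`f` from `A`. It remains to extend `f - f ∘ M` from the other rectangles without spoiling the zeros
on `A`. This is possible because a clamp onto a rectangle maps every rectangle that meets it into
itself, so vanishing on rectangles through `v` survives the induction
(`exists_memAC_extension_of_common_point`). Absolutely continuous bumps and compactness of `V` then
glue the local extensions (`IsGridlike.exists_memAC_extension`).

Two analytic facts make clamps and bumps available. A function with finite norm on both sides of a
line has finite norm on the union, since jumps across the line are counted by entry times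
(`bvNorm_le_of_halfPlanes`); hence composition with a map that is affine on each side of a line is
bounded. And the positive part of a linear coordinate is in `AC`, by `L¹` approximation of its
derivative by polynomials (`memAC_comp_lin`). -/

/-- The linear functional `x + i y ↦ a x + b y`. -/
def lin (a b : ℝ) (z : ℂ) : ℝ := a * z.re + b * z.im

lemma mem_line {a b c : ℝ} {z : ℂ} : z ∈ line a b c ↔ lin a b z = c := Iff.rfl

@[fun_prop]
lemma continuous_lin (a b : ℝ) : Continuous (lin a b) := by
  unfold lin
  fun_prop

lemma vfLine_le_vf (γ : C(unitInterval, ℂ)) {a b : ℝ} (h : (a, b) ≠ (0, 0)) (c : ℝ) :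
    vfLine γ (line a b c) ≤ vf γ :=
  le_iSup_of_le a (le_iSup_of_le b (le_iSup_of_le c (le_iSup_of_le h le_rfl)))

lemma one_le_vf (γ : C(unitInterval, ℂ)) : 1 ≤ vf γ := by
  have h := rho_le_one γ
  rw [rho, ENNReal.inv_le_one] at h
  exact_mod_cast h

lemma rho_mul_vf_le_one (γ : C(unitInterval, ℂ)) : rho γ * ((vf γ : ℕ∞) : ℝ≥0∞) ≤ 1 :=
  ENNReal.inv_mul_le_one _

/-- The first time in `[s, t]` on the line exists by the intermediate value theorem and compactness.
It lies after `s` because `γ s` is off the line, so it is an entry. The half-open `Ioc` makes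
entries from consecutive steps distinct. -/
lemma exists_entryTime (γ : C(unitInterval, ℂ)) {a b c : ℝ} {s t : unitInterval} (hst : s ≤ t)
    (hs : lin a b (γ s) ≠ c) (hc : c ∈ uIcc (lin a b (γ s)) (lin a b (γ t))) :
    ∃ r ∈ Ioc s t, r ∈ entryTimes γ (line a b c) := by
  have hcont : Continuous fun r => lin a b (γ r) := (continuous_lin a b).comp γ.continuous
  have hK : IsCompact (Icc s t ∩ {r | lin a b (γ r) = c}) :=
    isCompact_Icc.inter_right (isClosed_eq hcont continuous_const)
  have hne : (Icc s t ∩ {r | lin a b (γ r) = c}).Nonempty := by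
    have hpre : IsPreconnected (Icc s t) := by
      have : OrdConnected (Icc (0 : ℝ) 1) := ordConnected_Icc
      exact isPreconnected_Icc
    rcases le_total (lin a b (γ s)) (lin a b (γ t)) with h | h
    · rw [uIcc_of_le h] at hc
      obtain ⟨r, hr, hrc⟩ := hpre.intermediate_value (left_mem_Icc.2 hst) (right_mem_Icc.2 hst)
        hcont.continuousOn hc
      exact ⟨r, hr, hrc⟩
    · rw [uIcc_of_ge h] at hc
      obtain ⟨r, hr, hrc⟩ := hpre.intermediate_value (right_mem_Icc.2 hst) (left_mem_Icc.2 hst)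
        hcont.continuousOn hc
      exact ⟨r, hr, hrc⟩
  obtain ⟨r, ⟨hr, hrc⟩, hmin⟩ := hK.exists_isLeast hne
  have hsr : s < r := lt_of_le_of_ne hr.1 (by rintro rfl; exact hs hrc)
  refine ⟨r, ⟨hsr, hr.2⟩, hrc, Or.inr ⟨s, hsr, fun q hq hqc => ?_⟩⟩
  exact absurd (hmin ⟨⟨hq.1.le, hq.2.le.trans hr.2⟩, hqc⟩) (not_le.2 hq.2)

/-- The number of entry times up to the time `t`. -/
def entryCount (γ : C(unitInterval, ℂ)) (l : Set ℂ) (t : unitInterval) : ℝ≥0∞ :=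
  ((entryTimes γ l ∩ Iic t).encard : ℕ∞)

lemma entryCount_mono (γ : C(unitInterval, ℂ)) (l : Set ℂ) : Monotone (entryCount γ l) := by
  intro s t hst
  exact ENat.toENNReal_le.2 (encard_le_encard (inter_subset_inter_right _ (Iic_subset_Iic.2 hst)))

lemma entryCount_le_vf (γ : C(unitInterval, ℂ)) {a b : ℝ} (h : (a, b) ≠ (0, 0)) (c : ℝ)
    (t : unitInterval) : entryCount γ (line a b c) t ≤ (vf γ : ℕ∞) :=
  ENat.toENNReal_le.2 ((encard_le_encard inter_subset_left).trans (vfLine_le_vf γ h c))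

lemma entryCount_add_one_le (γ : C(unitInterval, ℂ)) {l : Set ℂ} {s t r : unitInterval}
    (hr : r ∈ Ioc s t) (hrl : r ∈ entryTimes γ l) :
    entryCount γ l s + 1 ≤ entryCount γ l t := by
  have h1 : r ∉ entryTimes γ l ∩ Iic s := fun h => absurd h.2 (not_le.2 hr.1)
  have h2 : insert r (entryTimes γ l ∩ Iic s) ⊆ entryTimes γ l ∩ Iic t := by
    rintro q (rfl | hq)
    · exact ⟨hrl, hr.2⟩
    · exact ⟨hq.1, le_trans hq.2 (hr.1.le.trans hr.2)⟩
  have h3 := encard_le_encard h2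
  rw [encard_insert_of_notMem h1] at h3
  have h4 := ENat.toENNReal_le.2 h3
  rwa [ENat.toENNReal_add, ENat.toENNReal_one] at h4

/-! ### Gluing along a line -/

/-- Moves the variation to subsets of the parameter interval, where a function on the plane can be
compared across different domains. -/
lemma cvar_restrict (σ : Set ℂ) (f : ℂ → ℂ) (γ : C(unitInterval, ℂ)) :
    cvar (σ.domRestrict f) γ = eVariationOn (f ∘ γ) (γ ⁻¹' σ) := by
  have h := eVariationOn.comp_eq_of_monotoneOn (f ∘ γ) (t := univ)
    (Subtype.val : {t : unitInterval // γ t ∈ σ} → unitInterval) (fun _ _ _ _ h => h)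
  rw [image_univ, show range (Subtype.val : {t : unitInterval // γ t ∈ σ} → unitInterval) = γ ⁻¹' σ
    from Subtype.range_coe] at h
  exact h

lemma bvNorm_congr {σ : Set ℂ} {f g : ℂ → ℂ} (h : EqOn f g σ) :
    bvNorm (σ.domRestrict f) = bvNorm (σ.domRestrict g) := by
  rw [Set.domRestrict_eq_domRestrict_iff.2 h]

lemma eVariationOn_add_edist_le (g : unitInterval → ℂ) {T : Set unitInterval} {s t : unitInterval}
    (hst : s ≤ t) (hs : s ∈ T) (ht : t ∈ T) :
    eVariationOn g (T ∩ Icc 0 s) + edist (g t) (g s) ≤ eVariationOn g (T ∩ Icc 0 t) := by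
  rw [← eVariationOn.Icc_add_Icc g (unitInterval.nonneg' : 0 ≤ s) hst hs]
  gcongr
  exact eVariationOn.edist_le g ⟨ht, hst, le_rfl⟩ ⟨hs, le_rfl, hst⟩

lemma eVariationOn_Icc_mono (g : unitInterval → ℂ) (T : Set unitInterval) {s t : unitInterval}
    (hst : s ≤ t) : eVariationOn g (T ∩ Icc 0 s) ≤ eVariationOn g (T ∩ Icc 0 t) :=
  eVariationOn.mono g (inter_subset_inter_right _ (Icc_subset_Icc_right hst))

-- A step staying on one side is charged to the variation there; a step changing sides costs at most
-- `2 * D`. Each upward change yields a new entry time. A downward change need not, but ups and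
-- downs alternate, so an entry pays for two changes, and the indicator records a downward change
-- not yet matched by an upward one.
open Classical in
lemma sum_edist_le_split {σ : Set ℂ} {f : ℂ → ℂ} {D : ℝ≥0∞} (hD : ∀ z ∈ σ, ‖f z‖ₑ ≤ D)
    (γ : C(unitInterval, ℂ)) (a b c : ℝ) {u : ℕ → unitInterval} (hu : Monotone u)
    (hσ : ∀ i, γ (u i) ∈ σ) (n : ℕ) :
    ∑ i ∈ Finset.range n, edist (f (γ (u (i + 1)))) (f (γ (u i))) ≤
      eVariationOn (f ∘ γ) (γ ⁻¹' (σ ∩ {z | lin a b z ≤ c}) ∩ Icc 0 (u n)) +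
      eVariationOn (f ∘ γ) (γ ⁻¹' (σ ∩ {z | c ≤ lin a b z}) ∩ Icc 0 (u n)) +
      2 * D * (2 * entryCount γ (line a b c) (u n) + if lin a b (γ (u n)) < c then 1 else 0) := by
  induction n with
  | zero => simp
  | succ n ih =>
    rw [Finset.sum_range_succ]
    have hn : u n ≤ u (n + 1) := hu n.le_succ
    have hdist : edist (f (γ (u (n + 1)))) (f (γ (u n))) ≤ 2 * D := by
      rw [edist_eq_enorm_sub, two_mul]
      exact enorm_sub_le.trans (add_le_add (hD _ (hσ _)) (hD _ (hσ _)))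
    have hm := eVariationOn_Icc_mono (f ∘ γ) (γ ⁻¹' (σ ∩ {z | lin a b z ≤ c})) hn
    have hp := eVariationOn_Icc_mono (f ∘ γ) (γ ⁻¹' (σ ∩ {z | c ≤ lin a b z})) hn
    have hE := entryCount_mono γ (line a b c) hn
    rcases lt_or_ge (lin a b (γ (u n))) c with h1 | h1 <;>
      rcases lt_or_ge (lin a b (γ (u (n + 1)))) c with h2 | h2
    · have hd := eVariationOn_add_edist_le (f ∘ γ)
        (T := γ ⁻¹' (σ ∩ {z | lin a b z ≤ c})) hn ⟨hσ _, h1.le⟩ ⟨hσ _, h2.le⟩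
      rw [if_pos h1] at ih
      rw [if_pos h2]
      refine (add_le_add_left ih _).trans ?_
      refine le_trans ?_ (add_le_add (add_le_add hd hp)
        (mul_le_mul' le_rfl (add_le_add (mul_le_mul' le_rfl hE) le_rfl)))
      simp only [Function.comp_apply]
      apply le_of_eq
      ring
    · obtain ⟨r, hr, hrl⟩ := exists_entryTime γ hn h1.ne (mem_uIcc_of_le h1.le h2)
      have hE' := entryCount_add_one_le γ hr hrl
      rw [if_pos h1] at ih
      rw [if_neg (not_lt.2 h2)]
      refine (add_le_add ih hdist).trans ?_
      refine le_trans ?_ (add_le_add (add_le_add hm hp)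
        (mul_le_mul' le_rfl (add_le_add (mul_le_mul' le_rfl hE') le_rfl)))
      apply le_of_eq
      ring
    · rw [if_neg (not_lt.2 h1)] at ih
      rw [if_pos h2]
      refine (add_le_add ih hdist).trans ?_
      refine le_trans ?_ (add_le_add (add_le_add hm hp)
        (mul_le_mul' le_rfl (add_le_add (mul_le_mul' le_rfl hE) le_rfl)))
      apply le_of_eq
      ring
    · have hd := eVariationOn_add_edist_le (f ∘ γ)
        (T := γ ⁻¹' (σ ∩ {z | c ≤ lin a b z})) hn ⟨hσ _, h1⟩ ⟨hσ _, h2⟩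
      rw [if_neg (not_lt.2 h1)] at ih
      rw [if_neg (not_lt.2 h2)]
      refine (add_le_add_left ih _).trans ?_
      refine le_trans ?_ (add_le_add (add_le_add hm hd)
        (mul_le_mul' le_rfl (add_le_add (mul_le_mul' le_rfl hE) le_rfl)))
      simp only [Function.comp_apply]
      apply le_of_eq
      ring

/-- Functions of bounded variation on the two sides of a line glue. -/
lemma bvNorm_le_of_halfPlanes (σ : Set ℂ) (f : ℂ → ℂ) {a b : ℝ} (hab : (a, b) ≠ (0, 0)) (c : ℝ) :
    bvNorm (σ.domRestrict f) ≤ 7 * (bvNorm ((σ ∩ {z | lin a b z ≤ c}).domRestrict f) +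
      bvNorm ((σ ∩ {z | c ≤ lin a b z}).domRestrict f)) := by
  set σm := σ ∩ {z | lin a b z ≤ c}
  set σp := σ ∩ {z | c ≤ lin a b z}
  set D := supNorm (σm.domRestrict f) + supNorm (σp.domRestrict f)
  have hD : ∀ z ∈ σ, ‖f z‖ₑ ≤ D := fun z hz => by
    rcases le_total (lin a b z) c with h | h
    · exact (le_supNorm (σm.domRestrict f) ⟨z, hz, h⟩).trans le_self_add
    · exact (le_supNorm (σp.domRestrict f) ⟨z, hz, h⟩).trans le_add_self
  have hsup : supNorm (σ.domRestrict f) ≤ D := iSup_le fun z => hD z z.2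
  -- The factor 6 bounds `2 * (2 * vf γ + 1)` by `6 * vf γ`, using `1 ≤ vf γ`; the weight `rho γ`
  -- then cancels `vf γ`.
  have hvar : var (σ.domRestrict f) ≤ var (σm.domRestrict f) + var (σp.domRestrict f) + 6 * D := by
    refine var_le_of_cvar_le fun γ => ?_
    have hc : cvar (σ.domRestrict f) γ ≤ cvar (σm.domRestrict f) γ + cvar (σp.domRestrict f) γ +
        6 * D * ((vf γ : ℕ∞) : ℝ≥0∞) := cvar_le fun n u hu => by
      refine (sum_edist_le_split hD γ a b c (u := fun i => (u i : unitInterval)) hu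
        (fun i => (u i).2) n).trans ?_
      rw [cvar_restrict, cvar_restrict]
      refine add_le_add (add_le_add (eVariationOn.mono _ inter_subset_left)
        (eVariationOn.mono _ inter_subset_left)) ?_
      have h1 : (1 : ℝ≥0∞) ≤ ((vf γ : ℕ∞) : ℝ≥0∞) := by exact_mod_cast one_le_vf γ
      have h2 : (if lin a b (γ (u n)) < c then (1 : ℝ≥0∞) else 0) ≤ ((vf γ : ℕ∞) : ℝ≥0∞) := by
        split_ifs
        · exact h1
        · exact zero_le
      refine (mul_le_mul' le_rfl (add_le_add (mul_le_mul' le_rfl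
        (entryCount_le_vf γ hab c _)) h2)).trans (le_of_eq ?_)
      ring
    calc rho γ * cvar (σ.domRestrict f) γ ≤ rho γ * (cvar (σm.domRestrict f) γ +
          cvar (σp.domRestrict f) γ + 6 * D * ((vf γ : ℕ∞) : ℝ≥0∞)) := by gcongr
      _ = rho γ * cvar (σm.domRestrict f) γ + rho γ * cvar (σp.domRestrict f) γ +
          6 * D * (rho γ * ((vf γ : ℕ∞) : ℝ≥0∞)) := by ring
      _ ≤ var (σm.domRestrict f) + var (σp.domRestrict f) + 6 * D * 1 := by
          gcongr
          · exact le_var _ γ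
          · exact le_var _ γ
          · exact rho_mul_vf_le_one γ
      _ = _ := by rw [mul_one]
  have h7 : ∀ x : ℝ≥0∞, x ≤ 7 * x := fun x => le_mul_of_one_le_left' (by norm_num)
  calc bvNorm (σ.domRestrict f)
      ≤ D + (var (σm.domRestrict f) + var (σp.domRestrict f) + 6 * D) := add_le_add hsup hvar
    _ ≤ D + (7 * var (σm.domRestrict f) + 7 * var (σp.domRestrict f) + 6 * D) := by
        gcongr <;> exact h7 _
    _ = _ := by simp only [bvNorm, D]; ring

/-! ### Composition with real affine maps -/

/-- Real affine self-maps of the plane. -/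
def IsRealAffine (L : ℂ → ℂ) : Prop :=
  Continuous L ∧ ∀ a b, ∃ a' b' c', ∀ z, lin a b (L z) = lin a' b' z + c'

/-- The preimage of a line under an affine map is a line, empty, or the whole plane. In the last two
cases the only possible entry time is `0`. -/
lemma vf_comp_le {L : ℂ → ℂ} (hL : IsRealAffine L) (γ : C(unitInterval, ℂ)) :
    vf (ContinuousMap.comp ⟨L, hL.1⟩ γ) ≤ vf γ := by
  refine iSup_le fun a => iSup_le fun b => iSup_le fun c => iSup_le fun _ => ?_
  obtain ⟨a', b', c', h⟩ := hL.2 a b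
  by_cases h0 : (a', b') = (0, 0)
  · obtain ⟨rfl, rfl⟩ := Prod.mk.inj h0
    have hc : ∀ t, (ContinuousMap.comp ⟨L, hL.1⟩ γ) t ∈ line a b c ↔ c' = c := fun t => by
      rw [mem_line]
      change lin a b (L (γ t)) = c ↔ _
      rw [h]
      simp [lin]
    have hsub : entryTimes (ContinuousMap.comp ⟨L, hL.1⟩ γ) (line a b c) ⊆ {0} := by
      rintro t ⟨ht, rfl | ⟨s, hst, hs⟩⟩
      · rfl
      · obtain ⟨r, hr⟩ := exists_between hst
        exact absurd ((hc r).2 ((hc t).1 ht)) (hs r hr)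
    exact (encard_le_encard hsub).trans ((encard_singleton _).le.trans (one_le_vf γ))
  · refine le_trans (le_of_eq ?_) (vfLine_le_vf γ h0 (c - c'))
    have hc : ∀ t, (ContinuousMap.comp ⟨L, hL.1⟩ γ) t ∈ line a b c ↔
        γ t ∈ line a' b' (c - c') := fun t => by
      rw [mem_line, mem_line, eq_sub_iff_add_eq, ← h]
      rfl
    simp only [vfLine, entryTimes, hc]

/-- Test `f` on the curve `L ∘ γ`, whose weight is at least that of `γ`. The map `L` may be
degenerate; projections onto lines are the case needed for clamps. -/
lemma bvNorm_comp_le_of_isRealAffine {L : ℂ → ℂ} (hL : IsRealAffine L) {σ τ : Set ℂ}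
    (h : MapsTo L σ τ) (f : ℂ → ℂ) : bvNorm (σ.domRestrict (f ∘ L)) ≤ bvNorm (τ.domRestrict f) := by
  refine add_le_add (iSup_le fun z => le_supNorm (τ.domRestrict f) ⟨L z, h z.2⟩) ?_
  refine var_le_of_cvar_le fun γ => le_trans ?_
    (le_var (τ.domRestrict f) (ContinuousMap.comp ⟨L, hL.1⟩ γ))
  refine mul_le_mul' ?_ ?_
  · exact ENNReal.inv_le_inv.2 (ENat.toENNReal_le.2 (vf_comp_le hL γ))
  · rw [cvar_restrict, cvar_restrict]
    exact eVariationOn.mono _ fun t ht => h ht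

lemma isRealAffine_id : IsRealAffine id := ⟨continuous_id, fun a b => ⟨a, b, 0, fun z => by simp⟩⟩

lemma isRealAffine_re_const (c : ℝ) : IsRealAffine fun z => ⟨z.re, c⟩ := by
  refine ⟨?_, fun a b => ⟨a, 0, b * c, fun z => by simp [lin]⟩⟩
  have : (fun z : ℂ => (⟨z.re, c⟩ : ℂ)) = fun z : ℂ => (z.re : ℂ) + c * Complex.I := by
    ext z; simp [Complex.mk_eq_add_mul_I]
  rw [this]
  fun_prop

lemma isRealAffine_const_im (c : ℝ) : IsRealAffine fun z => ⟨c, z.im⟩ := by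
  refine ⟨?_, fun a b => ⟨0, b, a * c, fun z => by simp [lin]; ring⟩⟩
  have : (fun z : ℂ => (⟨c, z.im⟩ : ℂ)) = fun z : ℂ => (c : ℂ) + z.im * Complex.I := by
    ext z; simp [Complex.mk_eq_add_mul_I]
  rw [this]
  fun_prop

/-- Composition with a map that is real affine on either side of a line. -/
lemma bvNorm_comp_le_of_halfPlanes {M L₁ L₂ : ℂ → ℂ} (h₁ : IsRealAffine L₁) (h₂ : IsRealAffine L₂)
    {a b c : ℝ} (hab : (a, b) ≠ (0, 0)) (hM₁ : ∀ z, lin a b z ≤ c → M z = L₁ z)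
    (hM₂ : ∀ z, c ≤ lin a b z → M z = L₂ z) {σ τ : Set ℂ} (h : MapsTo M σ τ) (f : ℂ → ℂ) :
    bvNorm (σ.domRestrict (f ∘ M)) ≤ 14 * bvNorm (τ.domRestrict f) := by
  refine (bvNorm_le_of_halfPlanes σ (f ∘ M) hab c).trans ?_
  have e₁ : EqOn (f ∘ M) (f ∘ L₁) (σ ∩ {z | lin a b z ≤ c}) := fun z hz => by
    simp [hM₁ z hz.2]
  have e₂ : EqOn (f ∘ M) (f ∘ L₂) (σ ∩ {z | c ≤ lin a b z}) := fun z hz => by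
    simp [hM₂ z hz.2]
  rw [bvNorm_congr e₁, bvNorm_congr e₂]
  have b₁ := bvNorm_comp_le_of_isRealAffine h₁ (σ := σ ∩ {z | lin a b z ≤ c}) (τ := τ)
    (fun z hz => hM₁ z hz.2 ▸ h hz.1) f
  have b₂ := bvNorm_comp_le_of_isRealAffine h₂ (σ := σ ∩ {z | c ≤ lin a b z}) (τ := τ)
    (fun z hz => hM₂ z hz.2 ▸ h hz.1) f
  refine (mul_le_mul' le_rfl (add_le_add b₁ b₂)).trans (le_of_eq ?_)
  ring

/-! ### Functions of one linear coordinate -/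

/-- A Banach indicatrix count: every step that jumps strictly over the level `c` starts off the line
and so forces its own entry. -/
lemma sum_indicator_uIoo_le (γ : C(unitInterval, ℂ)) (a b c : ℝ) {u : ℕ → unitInterval}
    (hu : Monotone u) (n : ℕ) :
    ∑ i ∈ Finset.range n, (uIoo (lin a b (γ (u i))) (lin a b (γ (u (i + 1))))).indicator
      (fun _ => (1 : ℝ≥0∞)) c ≤ entryCount γ (line a b c) (u n) := by
  induction n with
  | zero => simp
  | succ n ih =>
    rw [Finset.sum_range_succ]
    by_cases h : c ∈ uIoo (lin a b (γ (u n))) (lin a b (γ (u (n + 1))))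
    · have hne : lin a b (γ (u n)) ≠ c := by
        rintro rfl
        rcases le_total (lin a b (γ (u n))) (lin a b (γ (u (n + 1)))) with h' | h'
        · rw [uIoo_of_le h'] at h
          exact lt_irrefl _ h.1
        · rw [uIoo_of_ge h'] at h
          exact lt_irrefl _ h.2
      obtain ⟨r, hr, hrl⟩ := exists_entryTime γ (hu n.le_succ) hne (Ioo_subset_Icc_self h)
      rw [indicator_of_mem h]
      exact (add_le_add ih le_rfl).trans (entryCount_add_one_le γ hr hrl)
    · rw [indicator_of_notMem h, add_zero]
      exact ih.trans (entryCount_mono γ _ (hu n.le_succ))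

/-- If the increments of `G` are dominated by the integrals of `w`, then the variation of
`G (a x + b y)` is at most the integral of `w`. -/
lemma var_comp_lin_le {σ : Set ℂ} {G : ℝ → ℂ} {w : ℝ → ℝ≥0∞} (hw : Measurable w) {a b A B : ℝ}
    (hab : (a, b) ≠ (0, 0)) (hσ : ∀ z ∈ σ, lin a b z ∈ Icc A B)
    (hG : ∀ x ∈ Icc A B, ∀ y ∈ Icc A B, edist (G y) (G x) ≤ ∫⁻ t in uIoo x y, w t) :
    var (σ.domRestrict fun z => G (lin a b z)) ≤ ∫⁻ t in Icc A B, w t := by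
  refine var_le_of_cvar_le fun γ => ?_
  have hc : cvar (σ.domRestrict fun z => G (lin a b z)) γ ≤
      ((vf γ : ℕ∞) : ℝ≥0∞) * ∫⁻ t in Icc A B, w t := cvar_le fun n u hu => by
    set x : ℕ → ℝ := fun i => lin a b (γ (u i))
    have hx : ∀ i, x i ∈ Icc A B := fun i => hσ _ (u i).2
    have hsub : ∀ i, uIoo (x i) (x (i + 1)) ⊆ Icc A B := fun i t ht =>
      ⟨(le_min (hx i).1 (hx (i + 1)).1).trans ht.1.le,
        ht.2.le.trans (max_le (hx i).2 (hx (i + 1)).2)⟩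
    have hmeas : ∀ i, MeasurableSet (uIoo (x i) (x (i + 1))) := fun i => measurableSet_Ioo
    calc _ ≤ ∑ i ∈ Finset.range n, ∫⁻ t in uIoo (x i) (x (i + 1)), w t :=
          Finset.sum_le_sum fun i _ => hG _ (hx i) _ (hx (i + 1))
      _ = ∑ i ∈ Finset.range n, ∫⁻ t in Icc A B, (uIoo (x i) (x (i + 1))).indicator w t := by
          refine Finset.sum_congr rfl fun i _ => ?_
          rw [lintegral_indicator (hmeas i), Measure.restrict_restrict (hmeas i),
            inter_eq_left.2 (hsub i)]
      _ = ∫⁻ t in Icc A B, ∑ i ∈ Finset.range n, (uIoo (x i) (x (i + 1))).indicator w t :=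
          (lintegral_finsetSum _ fun i _ => hw.indicator (hmeas i)).symm
      -- At each level `t`, the number of steps jumping over `t` is at most `vf γ`.
      _ ≤ ∫⁻ t in Icc A B, ((vf γ : ℕ∞) : ℝ≥0∞) * w t := by
          refine lintegral_mono fun t => ?_
          have h1 : ∀ i, (uIoo (x i) (x (i + 1))).indicator w t =
              (uIoo (x i) (x (i + 1))).indicator (fun _ => (1 : ℝ≥0∞)) t * w t := fun i => by
            by_cases h : t ∈ uIoo (x i) (x (i + 1)) <;> simp [h]
          simp only [h1, ← Finset.sum_mul]
          refine mul_le_mul' ?_ le_rfl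
          exact (sum_indicator_uIoo_le γ a b t (u := fun i => (u i : unitInterval)) hu n).trans
            (entryCount_le_vf γ hab t _)
      _ = _ := lintegral_const_mul _ hw
  calc rho γ * cvar (σ.domRestrict fun z => G (lin a b z)) γ
      ≤ rho γ * (((vf γ : ℕ∞) : ℝ≥0∞) * ∫⁻ t in Icc A B, w t) := by gcongr
    _ = (rho γ * ((vf γ : ℕ∞) : ℝ≥0∞)) * ∫⁻ t in Icc A B, w t := (mul_assoc _ _ _).symm
    _ ≤ 1 * ∫⁻ t in Icc A B, w t := by gcongr; exact rho_mul_vf_le_one γ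
    _ = _ := one_mul _

lemma exists_lin_mem_Icc {σ : Set ℂ} (hσ : Bornology.IsBounded σ) (a b : ℝ) :
    ∃ A B, A ≤ B ∧ ∀ z ∈ σ, lin a b z ∈ Icc A B := by
  have h : IsCompact (lin a b '' closure σ) := hσ.isCompact_closure.image (continuous_lin a b)
  obtain ⟨A, hA⟩ := h.bddBelow
  obtain ⟨B, hB⟩ := h.bddAbove
  refine ⟨A, max A B, le_max_left _ _, fun z hz => ?_⟩
  have hz' := mem_image_of_mem (lin a b) (subset_closure hz)
  exact ⟨hA hz', (hB hz').trans (le_max_right _ _)⟩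

lemma bvNorm_comp_lin_lt_top {σ : Set ℂ} (hσ : Bornology.IsBounded σ) {a b : ℝ}
    (hab : (a, b) ≠ (0, 0)) : bvNorm (σ.domRestrict fun z => ((lin a b z : ℝ) : ℂ)) < ∞ := by
  obtain ⟨A, B, -, h⟩ := exists_lin_mem_Icc hσ a b
  refine ENNReal.add_lt_top.2 ⟨?_, ?_⟩
  · refine lt_of_le_of_lt (iSup_le fun z => ?_) (ENNReal.ofReal_lt_top (r := max |A| |B|))
    have hz := h z z.2
    rw [← ofReal_norm]
    refine ENNReal.ofReal_le_ofReal ?_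
    simp only [domRestrict_apply, Complex.norm_real, Real.norm_eq_abs]
    exact abs_le_max_abs_abs hz.1 hz.2
  · refine lt_of_le_of_lt (var_comp_lin_le (G := fun x => (x : ℂ)) (w := fun _ => 1)
      measurable_const hab h fun x _ y _ => ?_) ?_
    · rw [setLIntegral_one, uIoo, Real.volume_Ioo, edist_dist, Complex.dist_of_im_eq (by simp)]
      simp only [Complex.ofReal_re]
      rw [Real.dist_eq, max_sub_min_eq_abs]
    · rw [setLIntegral_one]
      exact measure_Icc_lt_top

/-! ### Absolutely continuous functions -/

/-- The function `f` restricts to an element of `AC(σ)`. -/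
def MemAC (σ : Set ℂ) (f : ℂ → ℂ) : Prop := ∃ F ∈ acSubalgebra σ, ∀ z : σ, F z = f z

/-- A function of finite norm as an element of `BV(σ)`. -/
def BV.mk {σ : Set ℂ} (f : σ → ℂ) (hf : bvNorm f < ∞) : BV σ := (⟨f, hf⟩ : bvSubalgebra σ)

@[simp] lemma BV.mk_apply {σ : Set ℂ} (f : σ → ℂ) (hf : bvNorm f < ∞) (z : σ) :
    BV.mk f hf z = f z := rfl

lemma BV.algebraMap_apply {σ : Set ℂ} (c : ℂ) (z : σ) : (algebraMap ℂ (BV σ) c) z = c := rfl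

section MemAC

variable {σ : Set ℂ} {f g : ℂ → ℂ}

lemma MemAC.congr (hf : MemAC σ f) (h : EqOn f g σ) : MemAC σ g := by
  obtain ⟨F, hF, hFf⟩ := hf
  exact ⟨F, hF, fun z => (hFf z).trans (h z.2)⟩

lemma MemAC.add (hf : MemAC σ f) (hg : MemAC σ g) : MemAC σ (fun z => f z + g z) := by
  obtain ⟨F, hF, hFf⟩ := hf
  obtain ⟨G, hG, hGg⟩ := hg
  exact ⟨F + G, add_mem hF hG, fun z => by rw [BV.add_apply, hFf, hGg]⟩

lemma MemAC.sub (hf : MemAC σ f) (hg : MemAC σ g) : MemAC σ (fun z => f z - g z) := by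
  obtain ⟨F, hF, hFf⟩ := hf
  obtain ⟨G, hG, hGg⟩ := hg
  exact ⟨F - G, sub_mem hF hG, fun z => by rw [BV.sub_apply, hFf, hGg]⟩

lemma MemAC.mul (hf : MemAC σ f) (hg : MemAC σ g) : MemAC σ (fun z => f z * g z) := by
  obtain ⟨F, hF, hFf⟩ := hf
  obtain ⟨G, hG, hGg⟩ := hg
  exact ⟨F * G, mul_mem hF hG, fun z => by rw [BV.mul_apply, hFf, hGg]⟩

lemma memAC_const (σ : Set ℂ) (c : ℂ) : MemAC σ (fun _ => c) :=
  ⟨algebraMap ℂ (BV σ) c, Subalgebra.algebraMap_mem _ c, fun z => BV.algebraMap_apply c z⟩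

lemma MemAC.bvNorm_lt_top (hf : MemAC σ f) : bvNorm (σ.domRestrict f) < ∞ := by
  obtain ⟨F, -, hFf⟩ := hf
  have : (F : σ → ℂ) = σ.domRestrict f := funext hFf
  rw [← this]
  exact F.bvNorm_lt_top

/-- `AC(σ)` is closed in the `BV` norm. -/
lemma memAC_of_forall_approx
    (h : ∀ ε > 0, ∃ g, MemAC σ g ∧ bvNorm (σ.domRestrict (f - g)) ≤ ENNReal.ofReal ε) :
    MemAC σ f := by
  have hf : bvNorm (σ.domRestrict f) < ∞ := by
    obtain ⟨g, hg, hfg⟩ := h 1 one_pos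
    have e : σ.domRestrict f = σ.domRestrict (f - g) + σ.domRestrict g := by ext; simp
    rw [e]
    exact (bvNorm_add_le _ _).trans_lt (ENNReal.add_lt_top.2
      ⟨hfg.trans_lt ENNReal.ofReal_lt_top, hg.bvNorm_lt_top⟩)
  refine ⟨BV.mk _ hf, ?_, fun z => rfl⟩
  have hcl : IsClosed (acSubalgebra σ : Set (BV σ)) := Subalgebra.isClosed_topologicalClosure _
  rw [← SetLike.mem_coe, ← hcl.closure_eq, Metric.mem_closure_iff]
  intro ε hε
  obtain ⟨g, ⟨G, hG, hGg⟩, hfg⟩ := h (ε / 2) (half_pos hε)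
  refine ⟨G, hG, lt_of_le_of_lt ?_ (half_lt_self hε)⟩
  rw [dist_eq_norm, BV.norm_def]
  refine ENNReal.toReal_le_of_le_ofReal (half_pos hε).le ?_
  have e : ((BV.mk _ hf - G : BV σ) : σ → ℂ) = σ.domRestrict (f - g) := by
    ext z
    simp [hGg]
  rwa [e]

/-- The generators of `acSubalgebra` are required to lie in `BV`, so the content is that the
coordinates have finite norm on a bounded set. -/
lemma memAC_id_and_conj (hσ : Bornology.IsBounded σ) :
    MemAC σ (fun z => z) ∧ MemAC σ (fun z => conj z) := by
  have hre : bvNorm (σ.domRestrict fun z => (z.re : ℂ)) < ∞ := by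
    have := bvNorm_comp_lin_lt_top hσ (a := 1) (b := 0) (by simp)
    simpa [lin] using this
  have him : bvNorm (σ.domRestrict fun z => (z.im : ℂ)) < ∞ := by
    have := bvNorm_comp_lin_lt_top hσ (a := 0) (b := 1) (by simp)
    simpa [lin] using this
  set X : BV σ := BV.mk _ hre
  set Y : BV σ := BV.mk _ him
  refine ⟨⟨X + Complex.I • Y, ?_, fun z => ?_⟩, ⟨X - Complex.I • Y, ?_, fun z => ?_⟩⟩
  · refine Subalgebra.le_topologicalClosure _ (Algebra.subset_adjoin (Or.inl fun z => ?_))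
    apply Complex.ext <;> simp [X, Y]
  · apply Complex.ext <;> simp [X, Y]
  · refine Subalgebra.le_topologicalClosure _ (Algebra.subset_adjoin (Or.inr fun z => ?_))
    apply Complex.ext <;> simp [X, Y]
  · apply Complex.ext <;> simp [X, Y]

lemma memAC_re (hσ : Bornology.IsBounded σ) : MemAC σ (fun z => (z.re : ℂ)) := by
  obtain ⟨h1, h2⟩ := memAC_id_and_conj hσ
  refine ((memAC_const σ (1 / 2)).mul (h1.add h2)).congr fun z _ => ?_
  apply Complex.ext <;> simp
  ring

lemma memAC_im (hσ : Bornology.IsBounded σ) : MemAC σ (fun z => (z.im : ℂ)) := by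
  obtain ⟨h1, h2⟩ := memAC_id_and_conj hσ
  refine ((memAC_const σ (-Complex.I / 2)).mul (h1.sub h2)).congr fun z _ => ?_
  apply Complex.ext <;> simp
  ring

lemma memAC_lin (hσ : Bornology.IsBounded σ) (a b : ℝ) :
    MemAC σ (fun z => ((lin a b z : ℝ) : ℂ)) :=
  (((memAC_const σ a).mul (memAC_re hσ)).add ((memAC_const σ b).mul (memAC_im hσ))).congr
    fun z _ => by simp [lin]

lemma memAC_eval_lin (hσ : Bornology.IsBounded σ) (a b : ℝ) (p : ℝ[X]) :
    MemAC σ (fun z => ((p.eval (lin a b z) : ℝ) : ℂ)) := by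
  induction p using Polynomial.induction_on with
  | C r => simpa using memAC_const σ (r : ℂ)
  | add p q hp hq => exact (hp.add hq).congr fun z _ => by simp
  | monomial n r h =>
    refine (h.mul (memAC_lin hσ a b)).congr fun z _ => ?_
    simp
    ring

/-- Continuous functions are dense in `L¹`, and Weierstrass approximates them uniformly on the
interval. -/
lemma exists_polynomial_lintegral_sub_le {h : ℝ → ℝ} {A B : ℝ}
    (hh : Integrable h (volume.restrict (Icc A B))) {ε : ℝ} (hε : 0 < ε) :
    ∃ q : ℝ[X], ∫⁻ t in Icc A B, ‖h t - q.eval t‖ₑ ≤ ENNReal.ofReal ε := by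
  obtain ⟨g, -, hg, hgc, -⟩ := hh.exists_hasCompactSupport_lintegral_sub_le
    (ε := ENNReal.ofReal (ε / 2)) (by simpa using half_pos hε)
  set δ : ℝ := ε / 2 / (|B - A| + 1)
  have hδ : 0 < δ := by positivity
  obtain ⟨q, hq⟩ := exists_polynomial_near_of_continuousOn A B g hgc.continuousOn δ hδ
  refine ⟨q, ?_⟩
  have h2 : ∫⁻ t in Icc A B, ‖g t - q.eval t‖ₑ ≤ ENNReal.ofReal (ε / 2) := by
    calc _ ≤ ∫⁻ _ in Icc A B, ENNReal.ofReal δ := by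
          refine setLIntegral_mono measurable_const fun t ht => ?_
          rw [← ofReal_norm]
          refine ENNReal.ofReal_le_ofReal ?_
          rw [Real.norm_eq_abs, abs_sub_comm]
          exact (hq t ht).le
      _ = ENNReal.ofReal (δ * (B - A)) := by
          rw [setLIntegral_const, Real.volume_Icc, ENNReal.ofReal_mul hδ.le]
      _ ≤ _ := by
          refine ENNReal.ofReal_le_ofReal ?_
          have h3 : δ * (|B - A| + 1) = ε / 2 := by
            simp only [δ]
            field_simp
          nlinarith [le_abs_self (B - A)]
  calc _ ≤ ∫⁻ t in Icc A B, (‖h t - g t‖ₑ + ‖g t - q.eval t‖ₑ) := by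
        refine lintegral_mono fun t => ?_
        have : h t - q.eval t = (h t - g t) + (g t - q.eval t) := by ring
        rw [this]
        exact enorm_add_le _ _
    _ = (∫⁻ t in Icc A B, ‖h t - g t‖ₑ) + ∫⁻ t in Icc A B, ‖g t - q.eval t‖ₑ := by
        refine lintegral_add_right _ ?_
        exact (hgc.sub q.continuous).measurable.enorm
    _ ≤ ENNReal.ofReal (ε / 2) + ENNReal.ofReal (ε / 2) := add_le_add hg h2
    _ = ENNReal.ofReal ε := by rw [← ENNReal.ofReal_add (by positivity) (by positivity), add_halves]

lemma exists_derivative_eq (q : ℝ[X]) : ∃ p : ℝ[X], derivative p = q := by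
  induction q using Polynomial.induction_on' with
  | add p q hp hq =>
    obtain ⟨P, rfl⟩ := hp
    obtain ⟨Q, rfl⟩ := hq
    exact ⟨P + Q, by simp⟩
  | monomial n r =>
    refine ⟨monomial (n + 1) (r / (n + 1)), ?_⟩
    rw [derivative_monomial]
    have : (n : ℝ) + 1 ≠ 0 := by positivity
    simp [this]

/-- Absolutely continuous functions of a linear coordinate are absolutely continuous. -/
lemma memAC_comp_lin (hσ : Bornology.IsBounded σ) {a b : ℝ} (hab : (a, b) ≠ (0, 0))
    {G h : ℝ → ℝ} (hm : Measurable h)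
    (hh : ∀ x y, IntervalIntegrable h volume x y)
    (hG : ∀ x y, ∫ t in x..y, h t = G y - G x) :
    MemAC σ (fun z => ((G (lin a b z) : ℝ) : ℂ)) := by
  obtain ⟨A, B, hAB, hlin⟩ := exists_lin_mem_Icc hσ a b
  refine memAC_of_forall_approx fun ε hε => ?_
  obtain ⟨q, hq⟩ := exists_polynomial_lintegral_sub_le
    ((intervalIntegrable_iff_integrableOn_Icc_of_le hAB).1 (hh A B)) (half_pos hε)
  obtain ⟨p, rfl⟩ := exists_derivative_eq q
  -- The primitive of the approximating polynomial is normalized to agree with `G` at `A`, so that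
  -- the increments of `G - P` control its supremum as well as its variation.
  set P : ℝ[X] := p + C (G A - p.eval A)
  have hPA : P.eval A = G A := by simp [P]
  refine ⟨_, memAC_eval_lin hσ a b P, ?_⟩
  set w : ℝ → ℝ≥0∞ := fun t => ‖h t - (derivative p).eval t‖ₑ
  have hw : Measurable w := (hm.sub (derivative p).continuous.measurable).enorm
  have hinc : ∀ x y, edist ((G y - P.eval y : ℝ) : ℂ) ((G x - P.eval x : ℝ) : ℂ) ≤
      ∫⁻ t in uIoo x y, w t := fun x y => by
    have hP : ∫ t in x..y, (derivative p).eval t = P.eval y - P.eval x := by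
      refine intervalIntegral.integral_eq_sub_of_hasDerivAt (f := fun t => P.eval t) (fun t _ => ?_)
        ((derivative p).continuous.intervalIntegrable _ _)
      have := P.hasDerivAt t
      simpa [P] using this
    have h1 : ∫ t in x..y, (h t - (derivative p).eval t) =
        (G y - P.eval y) - (G x - P.eval x) := by
      rw [intervalIntegral.integral_sub (hh x y)
        ((derivative p).continuous.intervalIntegrable _ _), hG, hP]
      ring
    rw [edist_eq_enorm_sub, ← Complex.ofReal_sub, ← h1]
    have h2 : ‖((∫ t in x..y, (h t - (derivative p).eval t) : ℝ) : ℂ)‖ₑ =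
        ‖∫ t in uIoc x y, (h t - (derivative p).eval t)‖ₑ := by
      rw [← ofReal_norm, ← ofReal_norm, Complex.norm_real,
        intervalIntegral.norm_intervalIntegral_eq]
    rw [h2]
    refine (enorm_integral_le_lintegral_enorm _).trans (le_of_eq ?_)
    rw [uIoo, uIoc, restrict_Ioo_eq_restrict_Ioc]
  have e : ((fun z => ((G (lin a b z) : ℝ) : ℂ)) - fun z => ((P.eval (lin a b z) : ℝ) : ℂ)) =
      fun z => ((fun x => ((G x - P.eval x : ℝ) : ℂ)) (lin a b z)) := by
    ext z
    simp
  rw [e]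
  have hvar := (var_comp_lin_le (σ := σ) hw hab hlin fun x _ y _ => hinc x y).trans hq
  have hsup : supNorm (σ.domRestrict fun z => (fun x => ((G x - P.eval x : ℝ) : ℂ)) (lin a b z)) ≤
      ENNReal.ofReal (ε / 2) := iSup_le fun z => by
    have hz := hlin z z.2
    have h1 := hinc A (lin a b z)
    rw [hPA, sub_self, Complex.ofReal_zero, edist_zero_right] at h1
    refine h1.trans (le_trans (lintegral_mono_set fun t ht => ?_) hq)
    rw [uIoo_of_le hz.1] at ht
    exact ⟨ht.1.le, ht.2.le.trans hz.2⟩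
  refine (add_le_add hsup hvar).trans (le_of_eq ?_)
  rw [← ENNReal.ofReal_add (by positivity) (by positivity), add_halves]

/-- The hinge is a primitive of the indicator of `Ioi c`. Clamps and bumps are built from hinges. -/
lemma memAC_posPart (hσ : Bornology.IsBounded σ) {a b : ℝ} (hab : (a, b) ≠ (0, 0)) (c : ℝ) :
    MemAC σ (fun z => ((max (lin a b z - c) 0 : ℝ) : ℂ)) := by
  have hm : Measurable ((Ioi c).indicator (fun _ => (1 : ℝ))) :=
    measurable_const.indicator measurableSet_Ioi
  have hh : ∀ x y, IntervalIntegrable ((Ioi c).indicator (fun _ => (1 : ℝ))) volume x y :=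
    fun x y => (((locallyIntegrable_const 1).indicator measurableSet_Ioi).integrableOn_isCompact
      isCompact_uIcc).intervalIntegrable
  refine memAC_comp_lin hσ hab (G := fun x => max (x - c) 0) hm hh fun x y => ?_
  refine integral_eq_of_hasDerivAt_off_countable (s := {c}) (fun x => max (x - c) 0) _
    (countable_singleton c)
    (by fun_prop) (fun t ht => ?_) (hh _ _)
  rcases lt_or_gt_of_ne ht.2 with h | h
  · rw [indicator_of_notMem (by simpa using h.le)]
    refine (hasDerivAt_const t (0 : ℝ)).congr_of_eventuallyEq ?_
    filter_upwards [Iio_mem_nhds h] with r hr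
    exact max_eq_right (sub_nonpos.2 (le_of_lt hr))
  · rw [indicator_of_mem (by exact h)]
    refine ((hasDerivAt_id t).sub_const c).congr_of_eventuallyEq ?_
    filter_upwards [Ioi_mem_nhds h] with r hr
    exact max_eq_left (sub_nonneg.2 (le_of_lt hr))

end MemAC

/-! ### Composition operators -/

lemma exists_domRestrict_eq {τ : Set ℂ} (f : τ → ℂ) : ∃ g : ℂ → ℂ, τ.domRestrict g = f :=
  ⟨Function.extend Subtype.val f 0, funext fun z => Subtype.val_injective.extend_apply f 0 z⟩

section compHom

variable {σ τ : Set ℂ} {M : ℂ → ℂ} (hM : MapsTo M σ τ) {C : ℝ≥0∞} (hC : C ≠ ∞)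
  (h : ∀ f : ℂ → ℂ, bvNorm (σ.domRestrict (f ∘ M)) ≤ C * bvNorm (τ.domRestrict f))

include h in
lemma bvNorm_comp_le (f : τ → ℂ) :
    bvNorm (fun z : σ => f ⟨M z, hM z.2⟩) ≤ C * bvNorm f := by
  obtain ⟨g, rfl⟩ := exists_domRestrict_eq f
  exact h g

/-- Composition with a map `M`, as a homomorphism from `BV(τ)` to `BV(σ)`. -/
def BV.compHom : BV τ →ₐ[ℂ] BV σ where
  toFun f := BV.mk (fun z => f ⟨M z, hM z.2⟩)
    ((bvNorm_comp_le hM h f).trans_lt (ENNReal.mul_lt_top hC.lt_top f.bvNorm_lt_top))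
  map_one' := rfl
  map_mul' _ _ := rfl
  map_zero' := rfl
  map_add' _ _ := rfl
  commutes' _ := rfl

lemma BV.compHom_apply (f : BV τ) (z : σ) : BV.compHom hM hC h f z = f ⟨M z, hM z.2⟩ := rfl

lemma BV.continuous_compHom : Continuous (BV.compHom hM hC h) := by
  refine AddMonoidHomClass.continuous_of_bound (BV.compHom hM hC h) C.toReal fun f => ?_
  rw [BV.norm_def, BV.norm_def, ← ENNReal.toReal_mul]
  exact ENNReal.toReal_mono (ENNReal.mul_lt_top hC.lt_top f.bvNorm_lt_top).ne
    (bvNorm_comp_le hM h f)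

/-- Composition is a continuous homomorphism, so only the generators need checking; they become `re
M ± i im M`. -/
lemma BV.compHom_mem_acSubalgebra (hre : MemAC σ fun z => ((M z).re : ℂ))
    (him : MemAC σ fun z => ((M z).im : ℂ)) {f : BV τ} (hf : f ∈ acSubalgebra τ) :
    BV.compHom hM hC h f ∈ acSubalgebra σ := by
  have key : acSubalgebra τ ≤ (acSubalgebra σ).comap (BV.compHom hM hC h) := by
    refine Subalgebra.topologicalClosure_minimal (Algebra.adjoin_le ?_)
      ((Subalgebra.isClosed_topologicalClosure _).preimage (BV.continuous_compHom hM hC h))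
    have hI := (memAC_const σ Complex.I).mul him
    rintro g (hg | hg)
    · obtain ⟨F, hF, hFf⟩ := hre.add hI
      have : BV.compHom hM hC h g = F := BV.ext fun z => by
        rw [BV.compHom_apply, hg, hFf]
        apply Complex.ext <;> simp
      rw [SetLike.mem_coe, Subalgebra.mem_comap, this]
      exact hF
    · obtain ⟨F, hF, hFf⟩ := hre.sub hI
      have : BV.compHom hM hC h g = F := BV.ext fun z => by
        rw [BV.compHom_apply, hg, hFf]
        apply Complex.ext <;> simp
      rw [SetLike.mem_coe, Subalgebra.mem_comap, this]
      exact hF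
  exact key hf

include hM hC h in
lemma MemAC.comp {f : ℂ → ℂ} (hf : MemAC τ f) (hre : MemAC σ fun z => ((M z).re : ℂ))
    (him : MemAC σ fun z => ((M z).im : ℂ)) : MemAC σ (f ∘ M) := by
  obtain ⟨F, hF, hFf⟩ := hf
  exact ⟨_, BV.compHom_mem_acSubalgebra hM hC h hre him hF, fun z => hFf _⟩

end compHom

lemma bvNorm_domRestrict_mono {σ τ : Set ℂ} (hστ : σ ⊆ τ) (f : ℂ → ℂ) :
    bvNorm (σ.domRestrict (f ∘ id)) ≤ 1 * bvNorm (τ.domRestrict f) := by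
  rw [one_mul]
  exact bvNorm_comp_le_of_isRealAffine isRealAffine_id hστ f

lemma MemAC.mono {σ τ : Set ℂ} {f : ℂ → ℂ} (hf : MemAC τ f) (hσ : Bornology.IsBounded σ)
    (hστ : σ ⊆ τ) : MemAC σ f :=
  MemAC.comp (M := id) hστ ENNReal.one_ne_top (bvNorm_domRestrict_mono hστ) hf (memAC_re hσ)
    (memAC_im hσ)

/-- The restriction homomorphism from `AC(τ)` to `AC(σ)`. -/
def restrictHom {σ τ : Set ℂ} (hστ : σ ⊆ τ) (hσ : Bornology.IsBounded σ) : AC τ →ₐ[ℂ] AC σ :=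
  ((BV.compHom (M := id) hστ ENNReal.one_ne_top (bvNorm_domRestrict_mono hστ)).comp
    (acSubalgebra τ).val).codRestrict (acSubalgebra σ) fun f =>
      BV.compHom_mem_acSubalgebra (M := id) hστ ENNReal.one_ne_top (bvNorm_domRestrict_mono hστ)
        (memAC_re hσ) (memAC_im hσ) f.2

lemma restrictHom_apply {σ τ : Set ℂ} (hστ : σ ⊆ τ) (hσ : Bornology.IsBounded σ) (f : AC τ)
    (z : σ) : (restrictHom hστ hσ f : BV σ) z = (f : BV τ) ⟨z, hστ z.2⟩ := rfl

lemma continuous_restrictHom {σ τ : Set ℂ} (hστ : σ ⊆ τ) (hσ : Bornology.IsBounded σ) :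
    Continuous (restrictHom hστ hσ) :=
  ((BV.continuous_compHom (M := id) hστ ENNReal.one_ne_top (bvNorm_domRestrict_mono hστ)).comp
    continuous_subtype_val).subtype_mk _

/-! ### Retractions onto rectangles -/

lemma isBounded_image {σ : Set ℂ} (hσ : Bornology.IsBounded σ) {M : ℂ → ℂ} (hM : Continuous M) :
    Bornology.IsBounded (M '' σ) :=
  (hσ.isCompact_closure.image hM).isBounded.subset (image_mono subset_closure)

/-- A continuous self-map of the plane such that composition with it preserves absolute continuity. -/
def IsACRetraction (M : ℂ → ℂ) : Prop :=
  Continuous M ∧ ∀ (σ τ : Set ℂ) (f : ℂ → ℂ), Bornology.IsBounded σ → MapsTo M σ τ →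
    MemAC τ f → MemAC σ (f ∘ M)

lemma IsACRetraction.comp {M N : ℂ → ℂ} (hM : IsACRetraction M) (hN : IsACRetraction N) :
    IsACRetraction (M ∘ N) := by
  refine ⟨hM.1.comp hN.1, fun σ τ f hσ h hf => ?_⟩
  refine hN.2 σ (N '' σ) (f ∘ M) hσ (mapsTo_image N σ)
    (hM.2 (N '' σ) τ f (isBounded_image hσ hN.1) ?_ hf)
  rintro _ ⟨z, hz, rfl⟩
  exact h hz

lemma isACRetraction_of_halfPlanes {M L₁ L₂ : ℂ → ℂ} (h₁ : IsRealAffine L₁) (h₂ : IsRealAffine L₂)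
    {a b c : ℝ} (hab : (a, b) ≠ (0, 0)) (hM₁ : ∀ z, lin a b z ≤ c → M z = L₁ z)
    (hM₂ : ∀ z, c ≤ lin a b z → M z = L₂ z)
    (hre : ∀ σ, Bornology.IsBounded σ → MemAC σ fun z => ((M z).re : ℂ))
    (him : ∀ σ, Bornology.IsBounded σ → MemAC σ fun z => ((M z).im : ℂ)) :
    IsACRetraction M := by
  refine ⟨?_, fun σ τ f hσ h hf => MemAC.comp h (C := 14) (by norm_num)
    (bvNorm_comp_le_of_halfPlanes h₁ h₂ hab hM₁ hM₂ h) hf (hre σ hσ) (him σ hσ)⟩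
  have hMe : M = fun z => if lin a b z ≤ c then L₁ z else L₂ z := by
    ext z : 1
    split_ifs with h
    · exact hM₁ z h
    · exact hM₂ z (not_le.1 h).le
  rw [hMe]
  refine Continuous.if_le h₁.1 h₂.1 (continuous_lin a b) continuous_const fun z hz => ?_
  rw [← hM₁ z hz.le, ← hM₂ z hz.ge]

/-- Projection onto the line `re = a` on its left, identity on its right; the moving coordinate is a
hinge plus a constant. -/
lemma isACRetraction_max_re (a : ℝ) : IsACRetraction fun z => ⟨max z.re a, z.im⟩ := by
  refine isACRetraction_of_halfPlanes (isRealAffine_const_im a) isRealAffine_id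
    (a := 1) (b := 0) (c := a) (by simp) (fun z hz => ?_) (fun z hz => ?_) (fun σ hσ => ?_)
    fun σ hσ => memAC_im hσ
  · simp only [lin, one_mul, zero_mul, add_zero] at hz
    simp [hz]
  · simp only [lin, one_mul, zero_mul, add_zero] at hz
    simp [hz]
  · refine ((memAC_posPart hσ (a := 1) (b := 0) (by simp) a).add (memAC_const σ a)).congr
      fun z _ => ?_
    simp only [lin, one_mul, zero_mul, add_zero]
    rw [← Complex.ofReal_add, ← max_add_add_right]
    simp

lemma isACRetraction_min_re (b : ℝ) : IsACRetraction fun z => ⟨min z.re b, z.im⟩ := by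
  refine isACRetraction_of_halfPlanes isRealAffine_id (isRealAffine_const_im b)
    (a := 1) (b := 0) (c := b) (by simp) (fun z hz => ?_) (fun z hz => ?_) (fun σ hσ => ?_)
    fun σ hσ => memAC_im hσ
  · simp only [lin, one_mul, zero_mul, add_zero] at hz
    simp [hz]
  · simp only [lin, one_mul, zero_mul, add_zero] at hz
    simp [hz]
  · refine ((memAC_re hσ).sub (memAC_posPart hσ (a := 1) (b := 0) (by simp) b)).congr
      fun z _ => ?_
    simp only [lin, one_mul, zero_mul, add_zero]
    rw [← Complex.ofReal_sub]
    congr 1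
    rcases le_total z.re b with h | h <;> simp [h]

lemma isACRetraction_max_im (c : ℝ) : IsACRetraction fun z => ⟨z.re, max z.im c⟩ := by
  refine isACRetraction_of_halfPlanes (isRealAffine_re_const c) isRealAffine_id
    (a := 0) (b := 1) (c := c) (by simp) (fun z hz => ?_) (fun z hz => ?_)
    (fun σ hσ => memAC_re hσ) fun σ hσ => ?_
  · simp only [lin, one_mul, zero_mul, zero_add] at hz
    simp [hz]
  · simp only [lin, one_mul, zero_mul, zero_add] at hz
    simp [hz]
  · refine ((memAC_posPart hσ (a := 0) (b := 1) (by simp) c).add (memAC_const σ c)).congr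
      fun z _ => ?_
    simp only [lin, one_mul, zero_mul, zero_add]
    rw [← Complex.ofReal_add, ← max_add_add_right]
    simp

lemma isACRetraction_min_im (d : ℝ) : IsACRetraction fun z => ⟨z.re, min z.im d⟩ := by
  refine isACRetraction_of_halfPlanes isRealAffine_id (isRealAffine_re_const d)
    (a := 0) (b := 1) (c := d) (by simp) (fun z hz => ?_) (fun z hz => ?_)
    (fun σ hσ => memAC_re hσ) fun σ hσ => ?_
  · simp only [lin, one_mul, zero_mul, zero_add] at hz
    simp [hz]
  · simp only [lin, one_mul, zero_mul, zero_add] at hz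
    simp [hz]
  · refine ((memAC_im hσ).sub (memAC_posPart hσ (a := 0) (b := 1) (by simp) d)).congr
      fun z _ => ?_
    simp only [lin, one_mul, zero_mul, zero_add]
    rw [← Complex.ofReal_sub]
    congr 1
    rcases le_total z.im d with h | h <;> simp [h]

/-- The common point `y` keeps the ends of `[a, b]` from pushing `x` out of `[a', b']`. -/
lemma clamp_mem_Icc_of_inter {a b a' b' x y : ℝ} (hx : x ∈ Icc a' b') (hy : y ∈ Icc a b)
    (hy' : y ∈ Icc a' b') : max (min x b) a ∈ Icc a' b' :=
  ⟨le_max_iff.2 (Or.inl (le_min hx.1 (hy'.1.trans hy.2))),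
    max_le (min_le_iff.2 (Or.inl hx.2)) (hy.1.trans hy'.2)⟩

/-- Clamp each coordinate. The last clause is the feature of axis-parallel rectangles on which the
extension argument rests. -/
lemma IsRectangle.exists_retraction {A : Set ℂ} (hA : IsRectangle A) :
    ∃ M, IsACRetraction M ∧ (∀ z, M z ∈ A) ∧ (∀ z ∈ A, M z = z) ∧
      ∀ B, IsRectangle B → (A ∩ B).Nonempty → MapsTo M B B := by
  obtain ⟨a, b, c, d, hab, hcd, rfl⟩ := hA
  refine ⟨fun z => ⟨max (min z.re b) a, max (min z.im d) c⟩,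
    (isACRetraction_max_im c).comp ((isACRetraction_min_im d).comp
      ((isACRetraction_max_re a).comp (isACRetraction_min_re b))), fun z => ?_, fun z hz => ?_, ?_⟩
  · rw [Complex.mem_reProdIm]
    exact ⟨⟨le_max_right _ _, max_le (min_le_right _ _) hab.le⟩,
      ⟨le_max_right _ _, max_le (min_le_right _ _) hcd.le⟩⟩
  · rw [Complex.mem_reProdIm] at hz
    apply Complex.ext
    · simp [hz.1.1, hz.1.2]
    · simp [hz.2.1, hz.2.2]
  · rintro _ ⟨a', b', c', d', -, -, rfl⟩ ⟨v, hv, hv'⟩ z hz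
    rw [Complex.mem_reProdIm] at *
    exact ⟨clamp_mem_Icc_of_inter hz.1 hv.1 hv'.1, clamp_mem_Icc_of_inter hz.2 hv.2 hv'.2⟩

lemma IsRectangle.isCompact {A : Set ℂ} (hA : IsRectangle A) : IsCompact A := by
  obtain ⟨a, b, c, d, -, -, rfl⟩ := hA
  exact isCompact_Icc.reProdIm isCompact_Icc

lemma IsGridlike.isCompact {V : Set ℂ} (hV : IsGridlike V) : IsCompact V := by
  obtain ⟨S, hS, -, hR, rfl⟩ := hV
  exact hS.isCompact_sUnion fun A hA => (hR A hA).isCompact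

/-! ### Extension of absolutely continuous functions -/

/-- Extension from a union of rectangles with a common point. -/
lemma exists_memAC_extension_of_common_point {σ : Set ℂ} (hσ : Bornology.IsBounded σ) (v : ℂ)
    {T : Set (Set ℂ)} (hT : T.Finite) (h : ∀ A ∈ T, IsRectangle A ∧ v ∈ A ∧ A ⊆ σ) {f : ℂ → ℂ}
    (hf : MemAC (⋃₀ T) f) :
    ∃ F, MemAC σ F ∧ EqOn F f (⋃₀ T) ∧ ∀ A, IsRectangle A → v ∈ A →
      (∀ z ∈ A, z ∈ ⋃₀ T → f z = 0) → ∀ z ∈ A, F z = 0 := by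
  induction T, hT using Set.Finite.induction_on generalizing f with
  | empty => exact ⟨fun _ => 0, memAC_const σ 0, by simp, fun _ _ _ _ _ _ => rfl⟩
  | @insert A₀ T _ _ ih =>
    obtain ⟨hA₀, hv₀, hA₀σ⟩ := h A₀ (mem_insert _ _)
    have hT : ∀ A ∈ T, IsRectangle A ∧ v ∈ A ∧ A ⊆ σ := fun A hA => h A (mem_insert_of_mem _ hA)
    have hTσ : ⋃₀ T ⊆ σ := sUnion_subset fun A hA => (hT A hA).2.2
    rw [sUnion_insert] at *
    obtain ⟨M, hM, hMA, hMid, hMB⟩ := hA₀.exists_retraction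
    have hfM : MemAC σ (f ∘ M) := hM.2 σ A₀ f hσ (fun z _ => hMA z)
      (hf.mono hA₀.isCompact.isBounded subset_union_left)
    -- The remainder `f - f ∘ M` vanishes on `A₀`. By the vanishing clause of the induction, so does
    -- its extension, even though `A₀` need not belong to `T`.
    obtain ⟨F, hF, hFf, hF0⟩ := ih hT (f := fun z => f z - (f ∘ M) z)
      ((hf.mono (hσ.subset hTσ) subset_union_right).sub (hfM.mono (hσ.subset hTσ) hTσ))
    refine ⟨_, hfM.add hF, ?_, fun A hA hvA hf0 z hz => ?_⟩
    · rintro z (hz | hz)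
      · have h0 := hF0 A₀ hA₀ hv₀ (fun y hy _ => by simp [hMid y hy]) z hz
        simp [h0, hMid z hz]
      · simp [hFf hz]
    -- `M` maps `A` into `A ∩ A₀`, so both `f ∘ M` and the remainder inherit the zeros of `f` on
    -- `A`.
    · have hMz : ∀ y ∈ A, f (M y) = 0 := fun y hy =>
        hf0 _ (hMB A hA ⟨v, hv₀, hvA⟩ hy) (Or.inl (hMA y))
      have h0 := hF0 A hA hvA (fun y hy hyT => by simp [hf0 y hy (Or.inr hyT), hMz y hy]) z hz
      simp [h0, hMz z hz]

/-- A trapezoid assembled from four hinges, with corners at `c ± δ` and `c ± 2 * δ`. -/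
lemma exists_memAC_plateau {σ : Set ℂ} (hσ : Bornology.IsBounded σ) {a b : ℝ}
    (hab : (a, b) ≠ (0, 0)) (c : ℝ) {δ : ℝ} (hδ : 0 < δ) :
    ∃ g, MemAC σ g ∧ (∀ z, |lin a b z - c| ≤ δ → g z = 1) ∧
      ∀ z, 2 * δ ≤ |lin a b z - c| → g z = 0 := by
  have hp := memAC_posPart hσ hab
  refine ⟨_, (memAC_const σ ((1 / δ : ℝ) : ℂ)).mul
    (((hp (c - 2 * δ)).sub (hp (c - δ))).sub ((hp (c + δ)).sub (hp (c + 2 * δ)))),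
    fun z hz => ?_, fun z hz => ?_⟩
  · rw [abs_le] at hz
    norm_cast
    rw [max_eq_left (by linarith), max_eq_left (by linarith), max_eq_right (by linarith),
      max_eq_right (by linarith)]
    field_simp
    ring
  · norm_cast
    rcases le_abs.1 hz with h | h
    · rw [max_eq_left (by linarith), max_eq_left (by linarith), max_eq_left (by linarith),
        max_eq_left (by linarith)]
      ring
    · rw [max_eq_right (by linarith), max_eq_right (by linarith), max_eq_right (by linarith),
        max_eq_right (by linarith)]
      ring

lemma exists_memAC_bump {σ : Set ℂ} (hσ : Bornology.IsBounded σ) {v : ℂ} {U : Set ℂ}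
    (hU : U ∈ 𝓝 v) :
    ∃ g, MemAC σ g ∧ (∀ᶠ z in 𝓝 v, g z = 1) ∧ ∀ z ∉ U, g z = 0 := by
  obtain ⟨ε, hε, hεU⟩ := Metric.mem_nhds_iff.1 hU
  -- Where both plateaus are nonzero, each coordinate is within `2 * (ε / 4)` of `v`, hence the
  -- point is within `ε`.
  have hδ : 0 < ε / 4 := by positivity
  obtain ⟨g, hg, hg1, hg0⟩ := exists_memAC_plateau hσ (a := 1) (b := 0) (by simp) v.re hδ
  obtain ⟨k, hk, hk1, hk0⟩ := exists_memAC_plateau hσ (a := 0) (b := 1) (by simp) v.im hδ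
  simp only [lin, one_mul, zero_mul, add_zero, zero_add] at hg1 hg0 hk1 hk0
  refine ⟨_, hg.mul hk, ?_, fun z hz => ?_⟩
  · filter_upwards [Metric.ball_mem_nhds v hδ] with z hz
    rw [Metric.mem_ball, dist_eq_norm] at hz
    rw [hg1 z (by simpa using (Complex.abs_re_le_norm (z - v)).trans hz.le),
      hk1 z (by simpa using (Complex.abs_im_le_norm (z - v)).trans hz.le), one_mul]
  · by_contra hne
    obtain ⟨h1, h2⟩ := mul_ne_zero_iff.1 hne
    have h1' := not_le.1 fun h => h1 (hg0 z h)
    have h2' := not_le.1 fun h => h2 (hk0 z h)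
    refine hz (hεU ?_)
    rw [Metric.mem_ball, dist_eq_norm]
    have := Complex.norm_le_abs_re_add_abs_im (z - v)
    simp only [Complex.sub_re, Complex.sub_im] at this
    linarith

/-- Absolutely continuous functions on a gridlike set extend to bounded supersets. -/
lemma IsGridlike.exists_memAC_extension {V σ : Set ℂ} (hV : IsGridlike V)
    (hσ : Bornology.IsBounded σ) (hVσ : V ⊆ σ) {f : ℂ → ℂ} (hf : MemAC V f) :
    ∃ F, MemAC σ F ∧ EqOn F f V := by
  have hVc := hV.isCompact
  obtain ⟨S, hS, -, hR, hVS⟩ := hV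
  -- Pairs with `F = β f` on `V` and `β = 1` on a piece `U` can be glued, which bare extensions
  -- cannot; compactness induction on `U` then applies.
  suffices h : ∃ β F : ℂ → ℂ, MemAC σ β ∧ MemAC σ F ∧ (∀ z ∈ V, β z = 1) ∧
      ∀ z ∈ V, F z = β z * f z by
    obtain ⟨β, F, -, hF, hβ, hFf⟩ := h
    exact ⟨F, hF, fun z hz => by rw [hFf z hz, hβ z hz, one_mul]⟩
  refine hVc.induction_on (p := fun U => ∃ β F : ℂ → ℂ, MemAC σ β ∧ MemAC σ F ∧
    (∀ z ∈ U, β z = 1) ∧ ∀ z ∈ V, F z = β z * f z) ?_ ?_ ?_ ?_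
  · exact ⟨fun _ => 0, fun _ => 0, memAC_const σ 0, memAC_const σ 0, by simp, by simp⟩
  · rintro s t hst ⟨β, F, hβ, hF, h1, h2⟩
    exact ⟨β, F, hβ, hF, fun z hz => h1 z (hst hz), h2⟩
  · rintro s t ⟨β, F, hβ, hF, h1, h2⟩ ⟨β', F', hβ', hF', h1', h2'⟩
    -- The new cutoff is `1 - (1 - β) (1 - β')`, equal to one wherever `β` or `β'` is.
    refine ⟨_, _, (hβ.add hβ').sub (hβ.mul hβ'), (hF.add hF').sub (hβ.mul hF'), ?_, fun z hz => ?_⟩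
    · rintro z (hz | hz)
      · rw [h1 z hz]
        ring
      · rw [h1' z hz]
        ring
    · rw [h2 z hz, h2' z hz]
      ring
  · intro v _
    set T := {A ∈ S | v ∈ A}
    have hTV : ⋃₀ T ⊆ V := hVS ▸ sUnion_mono (sep_subset _ _)
    -- The finitely many rectangles missing `v` have closed union; a bump vanishing there leaves
    -- only those through `v`.
    have hU : (⋃₀ {A ∈ S | v ∉ A})ᶜ ∈ 𝓝 v := by
      refine IsClosed.compl_mem_nhds ?_ ?_
      · exact ((hS.subset (sep_subset _ _)).isCompact_sUnion
          fun A hA => (hR A hA.1).isCompact).isClosed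
      · rintro ⟨A, hA, hvA⟩
        exact hA.2 hvA
    obtain ⟨β, hβ, hβ1, hβ0⟩ := exists_memAC_bump hσ hU
    obtain ⟨F, hF, hFf, -⟩ := exists_memAC_extension_of_common_point hσ v
      (hS.subset (sep_subset _ _)) (T := T) (fun A hA => ⟨hR A hA.1, hA.2,
        (subset_sUnion_of_mem hA).trans (hTV.trans hVσ)⟩)
      (hf.mono (hVc.isBounded.subset hTV) hTV)
    refine ⟨{z | β z = 1}, mem_nhdsWithin_of_mem_nhds hβ1, β, _, hβ, hβ.mul hF, fun z hz => hz,
      fun z hz => ?_⟩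
    by_cases hzU : z ∈ (⋃₀ {A ∈ S | v ∉ A})ᶜ
    · rw [hVS] at hz
      obtain ⟨A, hA, hzA⟩ := hz
      have hvA : v ∈ A := by
        by_contra hvA
        exact hzU ⟨A, ⟨hA, hvA⟩, hzA⟩
      rw [hFf ⟨A, ⟨hA, hvA⟩, hzA⟩]
    · rw [hβ0 z hzU, zero_mul, zero_mul]

lemma IsGridlike.restrictHom_surjective {V σ : Set ℂ} (hV : IsGridlike V)
    (hσ : Bornology.IsBounded σ) (hVσ : V ⊆ σ) :
    Function.Surjective (restrictHom hVσ (hσ.subset hVσ)) := by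
  intro f
  obtain ⟨g, hg⟩ := exists_domRestrict_eq ((f : BV V) : V → ℂ)
  obtain ⟨_, ⟨F, hF, hFf⟩, h⟩ := hV.exists_memAC_extension hσ hVσ (f := g)
    ⟨f, f.2, fun z => (congrFun hg z).symm⟩
  refine ⟨⟨F, hF⟩, Subtype.ext (BV.ext fun z => ?_)⟩
  rw [restrictHom_apply, ← hg]
  exact (hFf _).trans (h z.2)

end ACPlane
end

/-! ### The main theorem, by the open mapping theorem -/

open ACPlane in
theorem mainTheorem6 (V σ : Set ℂ) (hV : IsGridlike V) (hσ : IsCompact σ) (hVσ : V ⊆ σ) :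
    (∃ Θ : (AC σ ⧸ vanishingIdeal σ V) ≃A[ℂ] AC V, ∀ (f : AC σ) (z : ℂ) (hz : z ∈ V),
      (Θ (Ideal.Quotient.mk (vanishingIdeal σ V) f) : BV V) ⟨z, hz⟩ = (f : BV σ) ⟨z, hVσ hz⟩) ∧
    (∀ (R : Set ℂ) (_ : IsRectangle R) (hVR : V ⊆ R), ∃ C : ℝ, ∀ f : AC V, ∃ F : AC R,
      (∀ (z : ℂ) (hz : z ∈ V), (F : BV R) ⟨z, hVR hz⟩ = (f : BV V) ⟨z, hz⟩) ∧
        ‖F‖ ≤ C * ‖f‖) := by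
  constructor
  · set ρ := restrictHom hVσ (hσ.isBounded.subset hVσ)
    have hρ : Continuous ρ := continuous_restrictHom hVσ _
    have hsurj : Function.Surjective ρ := hV.restrictHom_surjective hσ.isBounded hVσ
    have hopen : IsOpenMap ρ :=
      ContinuousLinearMap.isOpenMap (⟨ρ.toLinearMap, hρ⟩ : AC σ →L[ℂ] AC V) hsurj
    have hker : ∀ f : AC σ, f ∈ vanishingIdeal σ V ↔ ρ f = 0 := fun f =>
      ⟨fun h => Subtype.ext (BV.ext fun z => h ⟨z, hVσ z.2⟩ z.2), fun h z hz => by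
        have h1 := restrictHom_apply hVσ (hσ.isBounded.subset hVσ) f ⟨z, hz⟩
        change (ρ f : BV V) ⟨z, hz⟩ = _ at h1
        rw [h] at h1
        exact h1.symm⟩
    set Φ : (AC σ ⧸ vanishingIdeal σ V) →ₐ[ℂ] AC V :=
      Ideal.Quotient.liftₐ (vanishingIdeal σ V) ρ fun f hf => (hker f).1 hf
    have hΦ : ∀ f, Φ (Ideal.Quotient.mk (vanishingIdeal σ V) f) = ρ f := fun f => rfl
    have hΦbij : Function.Bijective Φ := by
      refine ⟨(injective_iff_map_eq_zero Φ).2 fun q hq => ?_, fun g => ?_⟩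
      · obtain ⟨f, rfl⟩ := Ideal.Quotient.mk_surjective q
        rw [hΦ] at hq
        exact Ideal.Quotient.eq_zero_iff_mem.2 ((hker f).2 hq)
      · obtain ⟨f, rfl⟩ := hsurj g
        exact ⟨_, hΦ f⟩
    have hΦcont : Continuous Φ := continuous_quot_lift _ hρ
    have hΦopen : IsOpenMap Φ := fun U hU => by
      -- Openness passes from `ρ` to the quotient, because `Φ` has the same image on `U` as `ρ` on
      -- the preimage of `U`.
      have : Φ '' U = ρ '' (Ideal.Quotient.mk (vanishingIdeal σ V) ⁻¹' U) := by
        rw [← Set.image_preimage_eq U (Ideal.Quotient.mk_surjective (I := vanishingIdeal σ V)),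
          Set.image_image, Set.image_preimage_eq _ Ideal.Quotient.mk_surjective]
        rfl
      rw [this]
      exact hopen _ (hU.preimage continuous_quot_mk)
    let e := AlgEquiv.ofBijective Φ hΦbij
    refine ⟨⟨e, hΦcont, ?_⟩, fun f z hz => rfl⟩
    exact (Equiv.ofBijective Φ hΦbij).continuous_symm_iff.2 hΦopen
  · intro R hR hVR
    have hρ := continuous_restrictHom hVR (hR.isCompact.isBounded.subset hVR)
    obtain ⟨C, -, hC⟩ := ContinuousLinearMap.exists_preimage_norm_le
      (⟨(restrictHom hVR (hR.isCompact.isBounded.subset hVR)).toLinearMap, hρ⟩ : AC R →L[ℂ] AC V)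
      (hV.restrictHom_surjective hR.isCompact.isBounded hVR)
    refine ⟨C, fun f => ?_⟩
    obtain ⟨F, rfl, hF⟩ := hC f
    exact ⟨F, fun z hz => rfl, hF⟩
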